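/- Let $n\ge 1$ and let $M$ be a closed (compact, without boundary), connected smooth manifold of real dimension $2n+2$. A Hermitian structure $(J,g)$ on $M$ (that is, an integrable almost complex structure $J$ and a $J$-invariant Riemannian metric $g$) is called a Vaisman structure with Lee form $\theta$ if $\theta$ is a nonzero 1-form which is parallel for the Levi-Civita connection of $g$ and satisfies $d\omega=\theta\wedge\omega$, where $\omega(X,Y)=g(X,JY)$. Let $(J,g)$ be a Vaisman structure on $M$ whose Lee form $\theta$ is normalized by $\|\theta\|_g=1$. Put $\theta^c=-\theta\circ J$ and let $U=\theta^\sharp$, $V=(\theta^c)^\sharp$ be the $g$-dual vector fields (so $JU=V$); the canonical foliation $\Sigma$ is the one whose tangent distribution is spanned by $U$ and $V$. A 1-form $\zeta$ is basic if $\zeta(X)=0$ and $\mathrm{Lie}_X\zeta=0$ for every vector field $X$ tangent to $\Sigma$. Let $\{\zeta_t\}_{t\in\mathbb R}$ be a family of smooth basic 1-forms such that, for every $t$, the form $d\zeta_t$ is of type $(1,1)$ with respect to $J$ (i.e. $d\zeta_t(J\cdot,J\cdot)=d\zeta_t$), $$\|\zeta_t\|<\frac{1}{(2^{n+1}-1)\,n^{\frac{n-1}{2}}},\qquad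 \|d\zeta_t\|<\frac{1}{(2^{n+1}-1)\,n^{\frac{n-1}{2}}}$$ at every point of $M$ (pointwise norms of forms induced by $g$, for which the forms $e^{i_1}\wedge\dots\wedge e^{i_k}$, $i_1<\dots<i_k$, of an orthonormal coframe are orthonormal), and $$\min_{x\in M}\ \min_{v\in T_xM,\ g(v,v)=1} d\zeta_t(Jv,v)>-1 .$$ Define $$J_t=J-U\otimes\zeta_t-V\otimes(\zeta_t\circ J),\qquad g_t=g+d\zeta_t\circ(J\otimes \mathrm{Id})+\zeta_t\otimes\theta^c+\theta^c\otimes\zeta_t+\zeta_t\otimes\zeta_t .$$ Then, for every $t\in\mathbb R$, $J_t$ is a smooth integrable almost complex structure, $g_t$ is a smooth Riemannian metric, and $(J_t,g_t)$ is a Vaisman structure on $M$ with the same Lee form $\theta$, again with $\|\theta\|_{g_t}=1$; moreover its canonical foliation is the same foliation $\Sigma$. -/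

import Mathlib

open Bundle Module
open scoped Manifold ContDiff

noncomputable section

namespace Vaisman

variable {E : Type*} [NormedAddCommGroup E] [NormedSpace ℝ E] [FiniteDimensional ℝ E]
  {M : Type*} [TopologicalSpace M] [ChartedSpace E M] [IsManifold 𝓘(ℝ, E) ∞ M]

/-! ### Smooth tensor fields

The manifold `M` is modelled, without boundary, on the finite-dimensional real vector space `E`. -/

variable (E M) in
/-- Smooth Riemannian metrics on `M`. -/
abbrev Metric : Type _ :=
  ContMDiffRiemannianMetric 𝓘(ℝ, E) ∞ E (fun x : M => TangentSpace 𝓘(ℝ, E) x)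

variable (E M) in
/-- Smooth differential 1-forms on `M`. -/
structure OneForm where
  /-- The value of the form at a point. -/
  toFun : ∀ x : M, TangentSpace 𝓘(ℝ, E) x →L[ℝ] ℝ
  smooth : ContMDiff 𝓘(ℝ, E) (𝓘(ℝ, E).prod 𝓘(ℝ, E →L[ℝ] ℝ)) ∞
    (fun x => TotalSpace.mk' (E →L[ℝ] ℝ) (E := fun x : M => TangentSpace 𝓘(ℝ, E) x →L[ℝ] ℝ)
      x (toFun x))

instance : CoeFun (OneForm E M) (fun _ => ∀ x : M, TangentSpace 𝓘(ℝ, E) x →L[ℝ] ℝ) :=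
  ⟨OneForm.toFun⟩

variable (E M) in
/-- Smooth fields of endomorphisms of the tangent bundle of `M`. -/
structure EndoField where
  /-- The value of the field at a point. -/
  toFun : ∀ x : M, TangentSpace 𝓘(ℝ, E) x →L[ℝ] TangentSpace 𝓘(ℝ, E) x
  smooth : ContMDiff 𝓘(ℝ, E) (𝓘(ℝ, E).prod 𝓘(ℝ, E →L[ℝ] E)) ∞
    (fun x => TotalSpace.mk' (E →L[ℝ] E)
      (E := fun x : M => TangentSpace 𝓘(ℝ, E) x →L[ℝ] TangentSpace 𝓘(ℝ, E) x) x (toFun x))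

instance : CoeFun (EndoField E M)
    (fun _ => ∀ x : M, TangentSpace 𝓘(ℝ, E) x →L[ℝ] TangentSpace 𝓘(ℝ, E) x) :=
  ⟨EndoField.toFun⟩

/-- `X` is a smooth vector field on `M`. -/
def SmoothVF (X : ∀ x : M, TangentSpace 𝓘(ℝ, E) x) : Prop :=
  ContMDiff 𝓘(ℝ, E) 𝓘(ℝ, E).tangent ∞ (fun x => (X x : TangentBundle 𝓘(ℝ, E) M))

/-- The derivative `X f` of a function `f` along a vector field `X`. -/
def dirDeriv (X : ∀ x : M, TangentSpace 𝓘(ℝ, E) x) (f : M → ℝ) (x : M) : ℝ :=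
  mvfderiv 𝓘(ℝ, E) f x (X x)

/-- The Lie bracket of vector fields. -/
abbrev bracket (X Y : ∀ x : M, TangentSpace 𝓘(ℝ, E) x) : ∀ x : M, TangentSpace 𝓘(ℝ, E) x :=
  VectorField.mlieBracket 𝓘(ℝ, E) X Y

set_option linter.unusedSectionVars false

lemma OneForm.mdiffAt (α : OneForm E M) {X : ∀ x : M, TangentSpace 𝓘(ℝ, E) x} {x : M}
    (hX : MDiffAt (T% X) x) : MDiffAt (fun y => α y (X y)) x := by
  have h1 := (α.smooth.mdifferentiable (by simp) x).clm_bundle_apply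
    (E₂ := fun _ : M => ℝ) (b := fun y : M => y) hX
  simp only [mdifferentiableAt_totalSpace] at h1
  exact h1.2

lemma metric_mdiffAt (g : Metric E M) {X Y : ∀ x : M, TangentSpace 𝓘(ℝ, E) x} {x : M}
    (hX : MDiffAt (T% X) x) (hY : MDiffAt (T% Y) x) :
    MDiffAt (fun y => g.inner y (X y) (Y y)) x := by
  have h1 := (g.contMDiff.mdifferentiable (by simp) x).clm_bundle_apply₂
    (E₃ := fun _ : M => ℝ) (b := fun y : M => y) hX hY
  simp only [mdifferentiableAt_totalSpace] at h1
  exact h1.2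

/-! ### The exterior derivative -/

/-- The expression `X (α Y) - Y (α X) - α [X, Y]` for the exterior derivative of a 1-form. -/
def cartanOne (α : OneForm E M) (X Y : ∀ x : M, TangentSpace 𝓘(ℝ, E) x) (x : M) : ℝ :=
  dirDeriv X (fun y => α y (Y y)) x - dirDeriv Y (fun y => α y (X y)) x - α x (bracket X Y x)

lemma cartanOne_swap (α : OneForm E M) (X Y : ∀ x : M, TangentSpace 𝓘(ℝ, E) x) (x : M) :
    cartanOne α X Y x = - cartanOne α Y X x := by
  simp only [cartanOne, bracket]
  rw [VectorField.mlieBracket_swap_apply, map_neg]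
  ring

lemma cartanOne_tensorial (α : OneForm E M) (Y : ∀ x : M, TangentSpace 𝓘(ℝ, E) x) (x : M) :
    TensorialAt 𝓘(ℝ, E) E (cartanOne α · Y x) x where
  smul {f X} hf hX := by
    have h := mvfderiv_fun_mul hf (α.mdiffAt hX)
    simp only [cartanOne, dirDeriv, bracket, VectorField.mlieBracket_smul_left hf hX]
    simp [h]
    ring
  add {X X'} hX hX' := by
    have h := mvfderiv_fun_add (α.mdiffAt hX) (α.mdiffAt hX')
    simp only [cartanOne, dirDeriv, bracket, VectorField.mlieBracket_add_left hX hX']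
    simp [h]
    ring

lemma cartanOne_tensorial' (α : OneForm E M) (X : ∀ x : M, TangentSpace 𝓘(ℝ, E) x) (x : M) :
    TensorialAt 𝓘(ℝ, E) E (cartanOne α X · x) x where
  smul {f Y} hf hY := by
    have h := (cartanOne_tensorial α X x).smul hf hY
    simp only [cartanOne_swap α X, h, smul_eq_mul, mul_neg]
  add {Y Y'} hY hY' := by
    have h := (cartanOne_tensorial α X x).add hY hY'
    simp only [cartanOne_swap α X, h]
    ring

/-- The exterior derivative `dα` of a 1-form, as a bilinear form on each tangent space; it is
characterized by `dα(X, Y) = X (α Y) - Y (α X) - α [X, Y]`. -/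
def extD (α : OneForm E M) (x : M) :
    TangentSpace 𝓘(ℝ, E) x →L[ℝ] TangentSpace 𝓘(ℝ, E) x →L[ℝ] ℝ :=
  TensorialAt.mkHom₂ (cartanOne α · · x) x (fun Y _ => cartanOne_tensorial α Y x)
    (fun X _ => cartanOne_tensorial' α X x)

theorem extD_apply (α : OneForm E M) {X Y : ∀ x : M, TangentSpace 𝓘(ℝ, E) x} {x : M}
    (hX : MDiffAt (T% X) x) (hY : MDiffAt (T% Y) x) :
    extD α x (X x) (Y x) = cartanOne α X Y x :=
  TensorialAt.mkHom₂_apply _ _ hX hY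

/-- The exterior derivative `dΩ(X, Y, Z)` of a 2-form `Ω`, evaluated on vector fields. -/
def cartanTwo (Ω : ∀ x : M, TangentSpace 𝓘(ℝ, E) x → TangentSpace 𝓘(ℝ, E) x → ℝ)
    (X Y Z : ∀ x : M, TangentSpace 𝓘(ℝ, E) x) (x : M) : ℝ :=
  dirDeriv X (fun y => Ω y (Y y) (Z y)) x - dirDeriv Y (fun y => Ω y (X y) (Z y)) x
    + dirDeriv Z (fun y => Ω y (X y) (Y y)) x
    - Ω x (bracket X Y x) (Z x) + Ω x (bracket X Z x) (Y x) - Ω x (bracket Y Z x) (X x)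

/-- The value `(θ ∧ Ω)(u, v, w)` of the wedge product of a 1-form and a 2-form. -/
def wedgeOneTwo (θ : ∀ x : M, TangentSpace 𝓘(ℝ, E) x →L[ℝ] ℝ)
    (Ω : ∀ x : M, TangentSpace 𝓘(ℝ, E) x → TangentSpace 𝓘(ℝ, E) x → ℝ)
    (x : M) (u v w : TangentSpace 𝓘(ℝ, E) x) : ℝ :=
  θ x u * Ω x v w - θ x v * Ω x u w + θ x w * Ω x u v

/-! ### Musical isomorphism and the Levi-Civita connection -/

lemma exists_sharp (g : Metric E M) (x : M) :
    ∃ S : (TangentSpace 𝓘(ℝ, E) x →L[ℝ] ℝ) →ₗ[ℝ] TangentSpace 𝓘(ℝ, E) x,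
      ∀ α v, g.inner x (S α) v = α v := by
  have : T2Space (TangentSpace 𝓘(ℝ, E) x) := inferInstanceAs (T2Space E)
  have : FiniteDimensional ℝ (TangentSpace 𝓘(ℝ, E) x) := inferInstanceAs (FiniteDimensional ℝ E)
  let L : TangentSpace 𝓘(ℝ, E) x →ₗ[ℝ] (TangentSpace 𝓘(ℝ, E) x →ₗ[ℝ] ℝ) :=
    (LinearMap.toContinuousLinearMap (𝕜 := ℝ) (E := TangentSpace 𝓘(ℝ, E) x)
      (F' := ℝ)).symm.toLinearMap ∘ₗ (g.inner x).toLinearMap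
  have hL : ∀ v w, L v w = g.inner x v w := fun v w => rfl
  have hinj : Function.Injective L := by
    rw [← LinearMap.ker_eq_bot, LinearMap.ker_eq_bot']
    intro v hv
    by_contra hne
    have h := g.pos x v hne
    rw [← hL, hv] at h
    simp at h
  let e := LinearEquiv.ofInjectiveOfFinrankEq L hinj (Subspace.dual_finrank_eq).symm
  refine ⟨e.symm.toLinearMap ∘ₗ (LinearMap.toContinuousLinearMap (𝕜 := ℝ)
    (E := TangentSpace 𝓘(ℝ, E) x) (F' := ℝ)).symm.toLinearMap, fun α v => ?_⟩
  rw [← hL]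
  have h : L (e.symm (LinearMap.toContinuousLinearMap.symm α))
      = LinearMap.toContinuousLinearMap.symm α := e.apply_symm_apply _
  simp only [LinearMap.comp_apply, LinearEquiv.coe_coe]
  rw [h]
  rfl

/-- The vector `α^♯` that is `g`-dual to the covector `α`. -/
def sharp (g : Metric E M) (x : M) :
    (TangentSpace 𝓘(ℝ, E) x →L[ℝ] ℝ) →ₗ[ℝ] TangentSpace 𝓘(ℝ, E) x :=
  (exists_sharp g x).choose

theorem inner_sharp (g : Metric E M) (x : M) (α : TangentSpace 𝓘(ℝ, E) x →L[ℝ] ℝ)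
    (v : TangentSpace 𝓘(ℝ, E) x) : g.inner x (sharp g x α) v = α v :=
  (exists_sharp g x).choose_spec α v

lemma inner_ext (g : Metric E M) {x : M} {u v : TangentSpace 𝓘(ℝ, E) x}
    (h : ∀ w, g.inner x u w = g.inner x v w) : u = v := by
  by_contra hne
  have h1 := g.pos x (u - v) (sub_ne_zero.2 hne)
  simp [h] at h1

/-- The right-hand side of the Koszul formula for `2 g(∇_X Y, Z)`. -/
def koszul (g : Metric E M) (X Y Z : ∀ x : M, TangentSpace 𝓘(ℝ, E) x) (x : M) : ℝ :=
  dirDeriv X (fun y => g.inner y (Y y) (Z y)) x + dirDeriv Y (fun y => g.inner y (Z y) (X y)) x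
    - dirDeriv Z (fun y => g.inner y (X y) (Y y)) x
    + g.inner x (bracket X Y x) (Z x) - g.inner x (bracket X Z x) (Y x)
    - g.inner x (bracket Y Z x) (X x)

lemma koszul_tensorial_left (g : Metric E M) (Y Z : ∀ x : M, TangentSpace 𝓘(ℝ, E) x) (x : M)
    (hY : MDiffAt (T% Y) x) (hZ : MDiffAt (T% Z) x) :
    TensorialAt 𝓘(ℝ, E) E (koszul g · Y Z x) x where
  smul {f X} hf hX := by
    have h1 := mvfderiv_fun_mul hf (metric_mdiffAt g hZ hX)
    have h2 := mvfderiv_fun_mul hf (metric_mdiffAt g hX hY)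
    simp only [koszul, dirDeriv, bracket, VectorField.mlieBracket_smul_left hf hX]
    simp [h1, h2, g.symm x (Z x) (X x), g.symm x (X x) (Y x)]
    ring
  add {X X'} hX hX' := by
    have h1 := mvfderiv_fun_add (metric_mdiffAt g hZ hX) (metric_mdiffAt g hZ hX')
    have h2 := mvfderiv_fun_add (metric_mdiffAt g hX hY) (metric_mdiffAt g hX' hY)
    simp only [koszul, dirDeriv, bracket, VectorField.mlieBracket_add_left hX hX']
    simp [h1, h2]
    ring

lemma koszul_tensorial_right (g : Metric E M) (X Y : ∀ x : M, TangentSpace 𝓘(ℝ, E) x) (x : M)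
    (hX : MDiffAt (T% X) x) (hY : MDiffAt (T% Y) x) :
    TensorialAt 𝓘(ℝ, E) E (koszul g X Y · x) x where
  smul {f Z} hf hZ := by
    have h1 := mvfderiv_fun_mul hf (metric_mdiffAt g hY hZ)
    have h2 := mvfderiv_fun_mul hf (metric_mdiffAt g hZ hX)
    simp only [koszul, dirDeriv, bracket, VectorField.mlieBracket_smul_right hf hZ]
    simp [h1, h2, g.symm x (Z x) (X x), g.symm x (Z x) (Y x)]
    ring
  add {Z Z'} hZ hZ' := by
    have h1 := mvfderiv_fun_add (metric_mdiffAt g hY hZ) (metric_mdiffAt g hY hZ')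
    have h2 := mvfderiv_fun_add (metric_mdiffAt g hZ hX) (metric_mdiffAt g hZ' hX)
    simp only [koszul, dirDeriv, bracket, VectorField.mlieBracket_add_right hZ hZ']
    simp [h1, h2]
    ring

lemma koszul_add (g : Metric E M) {X Y Y' Z : ∀ x : M, TangentSpace 𝓘(ℝ, E) x} {x : M}
    (hX : MDiffAt (T% X) x) (hY : MDiffAt (T% Y) x) (hY' : MDiffAt (T% Y') x)
    (hZ : MDiffAt (T% Z) x) :
    koszul g X (Y + Y') Z x = koszul g X Y Z x + koszul g X Y' Z x := by
  have h1 := mvfderiv_fun_add (metric_mdiffAt g hY hZ) (metric_mdiffAt g hY' hZ)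
  have h2 := mvfderiv_fun_add (metric_mdiffAt g hX hY) (metric_mdiffAt g hX hY')
  simp only [koszul, dirDeriv, bracket, VectorField.mlieBracket_add_right hY hY',
    VectorField.mlieBracket_add_left hY hY']
  simp [h1, h2]
  ring

lemma koszul_smul (g : Metric E M) {X Y Z : ∀ x : M, TangentSpace 𝓘(ℝ, E) x} {f : M → ℝ} {x : M}
    (hX : MDiffAt (T% X) x) (hY : MDiffAt (T% Y) x) (hf : MDiffAt f x)
    (hZ : MDiffAt (T% Z) x) :
    koszul g X (f • Y) Z x
      = f x * koszul g X Y Z x + 2 * (dirDeriv X f x * g.inner x (Y x) (Z x)) := by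
  have h1 := mvfderiv_fun_mul hf (metric_mdiffAt g hY hZ)
  have h2 := mvfderiv_fun_mul hf (metric_mdiffAt g hX hY)
  simp only [koszul, dirDeriv, bracket, VectorField.mlieBracket_smul_right hf hY,
    VectorField.mlieBracket_smul_left hf hY]
  simp [h1, h2, g.symm x (Y x) (X x)]
  ring

open Classical in
/-- The Levi-Civita derivative `v ↦ ∇_v Y` at `x`, given by the Koszul formula. -/
def leviCivitaFun (g : Metric E M) (Y : ∀ x : M, TangentSpace 𝓘(ℝ, E) x) (x : M) :
    TangentSpace 𝓘(ℝ, E) x →L[ℝ] TangentSpace 𝓘(ℝ, E) x :=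
  haveI : T2Space (TangentSpace 𝓘(ℝ, E) x) := inferInstanceAs (T2Space E)
  haveI : FiniteDimensional ℝ (TangentSpace 𝓘(ℝ, E) x) :=
    inferInstanceAs (FiniteDimensional ℝ E)
  if hY : MDiffAt (T% Y) x then
    (2⁻¹ : ℝ) • LinearMap.toContinuousLinearMap (sharp g x ∘ₗ
      (TensorialAt.mkHom₂ (F := E) (F' := E) (I := 𝓘(ℝ, E)) (fun X Z => koszul g X Y Z x) x
        (fun Z hZ => koszul_tensorial_left g Y Z x hY hZ)
        (fun X hX => koszul_tensorial_right g X Y x hX hY)).toLinearMap)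
  else 0

theorem leviCivitaFun_koszul (g : Metric E M) {X Y Z : ∀ x : M, TangentSpace 𝓘(ℝ, E) x} {x : M}
    (hX : MDiffAt (T% X) x) (hY : MDiffAt (T% Y) x) (hZ : MDiffAt (T% Z) x) :
    2 * g.inner x (leviCivitaFun g Y x (X x)) (Z x) = koszul g X Y Z x := by
  simp only [leviCivitaFun, dif_pos hY]
  simp [inner_sharp]
  exact TensorialAt.mkHom₂_apply _ _ hX hZ

/-- The Levi-Civita connection of `g`; `leviCivita g Y x v` is `∇_v Y` at `x`. -/
def leviCivita (g : Metric E M) :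
    CovariantDerivative 𝓘(ℝ, E) E (TangentSpace 𝓘(ℝ, E) : M → Type _) where
  toFun := leviCivitaFun g
  isCovariantDerivativeOnUniv :=
    { add := by
        intro Y Y' x hY hY' _
        ext v
        refine inner_ext g fun w => ?_
        have hX := FiberBundle.mdifferentiableAt_extend 𝓘(ℝ, E) (F := E) v
        have hZ := FiberBundle.mdifferentiableAt_extend 𝓘(ℝ, E) (F := E) w
        have h := koszul_add g hX hY hY' hZ
        rw [← leviCivitaFun_koszul g hX (mdifferentiableAt_add_section hY hY') hZ,
          ← leviCivitaFun_koszul g hX hY hZ, ← leviCivitaFun_koszul g hX hY' hZ] at h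
        simp at h ⊢
        linarith
      leibniz := by
        intro Y f x hY hf _
        ext v
        refine inner_ext g fun w => ?_
        have hX := FiberBundle.mdifferentiableAt_extend 𝓘(ℝ, E) (F := E) v
        have hZ := FiberBundle.mdifferentiableAt_extend 𝓘(ℝ, E) (F := E) w
        have h := koszul_smul g hX hY hf hZ
        rw [← leviCivitaFun_koszul g hX (hf.smul_section hY) hZ,
          ← leviCivitaFun_koszul g hX hY hZ] at h
        simp [dirDeriv] at h ⊢
        linarith }

/-- The Koszul formula. -/
theorem leviCivita_koszul (g : Metric E M) {X Y Z : ∀ x : M, TangentSpace 𝓘(ℝ, E) x} {x : M}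
    (hX : MDiffAt (T% X) x) (hY : MDiffAt (T% Y) x) (hZ : MDiffAt (T% Z) x) :
    2 * g.inner x (leviCivita g Y x (X x)) (Z x) = koszul g X Y Z x :=
  leviCivitaFun_koszul g hX hY hZ

/-- The Levi-Civita connection is torsion-free. -/
theorem leviCivita_torsion (g : Metric E M) : (leviCivita g).torsion = 0 := by
  rw [CovariantDerivative.torsion_eq_zero_iff]
  intro X Y x hX hY
  refine inner_ext g fun w => ?_
  have hZ := FiberBundle.mdifferentiableAt_extend 𝓘(ℝ, E) (F := E) w
  have h1 := leviCivita_koszul g hX hY hZ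
  have h2 := leviCivita_koszul g hY hX hZ
  have e1 : bracket Y X x = - bracket X Y x := VectorField.mlieBracket_swap_apply
  have e2 : ∀ A B : ∀ x : M, TangentSpace 𝓘(ℝ, E) x,
      (fun y => g.inner y (A y) (B y)) = fun y => g.inner y (B y) (A y) :=
    fun A B => funext fun y => g.symm y _ _
  simp only [koszul, e1, e2 Y X, e2 (FiberBundle.extend E w) X, e2 (FiberBundle.extend E w) Y,
    map_neg, neg_apply, FiberBundle.extend_apply_self] at h1 h2
  simp only [map_sub, sub_apply]
  change _ = g.inner x (bracket X Y x) w
  linarith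

/-- The Levi-Civita connection is compatible with the metric. -/
theorem leviCivita_metric (g : Metric E M) {X Y Z : ∀ x : M, TangentSpace 𝓘(ℝ, E) x} {x : M}
    (hX : MDiffAt (T% X) x) (hY : MDiffAt (T% Y) x) (hZ : MDiffAt (T% Z) x) :
    dirDeriv X (fun y => g.inner y (Y y) (Z y)) x
      = g.inner x (leviCivita g Y x (X x)) (Z x) + g.inner x (Y x) (leviCivita g Z x (X x)) := by
  have h1 := leviCivita_koszul g hX hY hZ
  have h2 := leviCivita_koszul g hX hZ hY
  have e1 : bracket Z Y x = - bracket Y Z x := VectorField.mlieBracket_swap_apply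
  have e2 : ∀ A B : ∀ x : M, TangentSpace 𝓘(ℝ, E) x,
      (fun y => g.inner y (A y) (B y)) = fun y => g.inner y (B y) (A y) :=
    fun A B => funext fun y => g.symm y _ _
  rw [g.symm x (Y x)]
  simp only [koszul, e1, e2 Y X, e2 Z X, e2 Z Y, map_neg, neg_apply]
    at h1 h2
  linarith

/-- The 1-form `θ` is parallel for the Levi-Civita connection of `g`, that is,
`v (θ Y) = θ(∇_v Y)` for all smooth vector fields `Y` and all tangent vectors `v`. -/
def IsParallel (g : Metric E M) (θ : OneForm E M) : Prop :=
  ∀ Y : ∀ x : M, TangentSpace 𝓘(ℝ, E) x, SmoothVF Y →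
    ∀ (x : M) (v : TangentSpace 𝓘(ℝ, E) x),
      mvfderiv 𝓘(ℝ, E) (fun y => θ y (Y y)) x v = θ x (leviCivita g Y x v)

/-! ### Pointwise norms of forms -/

lemma exists_orthonormal (g : Metric E M) (x : M) :
    ∃ b : Basis (Fin (finrank ℝ E)) ℝ (TangentSpace 𝓘(ℝ, E) x),
      ∀ i j, g.inner x (b i) (b j) = if i = j then 1 else 0 := by
  let _ : RiemannianBundle (fun x : M => TangentSpace 𝓘(ℝ, E) x) := ⟨g.toRiemannianMetric⟩
  have : FiniteDimensional ℝ (TangentSpace 𝓘(ℝ, E) x) :=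
    inferInstanceAs (FiniteDimensional ℝ E)
  let b := stdOrthonormalBasis ℝ (TangentSpace 𝓘(ℝ, E) x)
  refine ⟨b.toBasis, fun i j => ?_⟩
  have h : inner ℝ (b.toBasis i) (b.toBasis j) = if i = j then (1 : ℝ) else 0 := by
    rw [OrthonormalBasis.coe_toBasis]
    exact orthonormal_iff_ite.1 b.orthonormal i j
  exact h

/-- A `g`-orthonormal basis of the tangent space at `x`. -/
def orthonormalFrame (g : Metric E M) (x : M) :
    Basis (Fin (finrank ℝ E)) ℝ (TangentSpace 𝓘(ℝ, E) x) :=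
  (exists_orthonormal g x).choose

/-- The norm of a covector: `|α|² = ∑ i, α(e i)²` for an orthonormal basis `e`. -/
def normOne (g : Metric E M) (x : M) (α : TangentSpace 𝓘(ℝ, E) x →L[ℝ] ℝ) : ℝ :=
  Real.sqrt (∑ i, α (orthonormalFrame g x i) ^ 2)

/-- The norm of an alternating 2-form: `|β|² = ∑ i < j, β(e i, e j)²` for an orthonormal
basis `e`. -/
def normTwo (g : Metric E M) (x : M)
    (β : TangentSpace 𝓘(ℝ, E) x →L[ℝ] TangentSpace 𝓘(ℝ, E) x →L[ℝ] ℝ) : ℝ :=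
  Real.sqrt (∑ i, ∑ j ∈ Finset.Ioi i, β (orthonormalFrame g x i) (orthonormalFrame g x j) ^ 2)

/-! ### Hermitian and Vaisman structures -/

/-- The Nijenhuis tensor of `J`, evaluated on vector fields. -/
def nijenhuis (J : EndoField E M) (X Y : ∀ x : M, TangentSpace 𝓘(ℝ, E) x) (x : M) :
    TangentSpace 𝓘(ℝ, E) x :=
  J x (J x (bracket X Y x)) - J x (bracket (fun y => J y (X y)) Y x)
    - J x (bracket X (fun y => J y (Y y)) x) + bracket (fun y => J y (X y)) (fun y => J y (Y y)) x

/-- `(J, g)` is a Hermitian structure: `J` is an integrable almost complex structure and `g` is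
`J`-invariant. -/
structure IsHermitianStructure (J : EndoField E M) (g : Metric E M) : Prop where
  sq : ∀ (x : M) (v : TangentSpace 𝓘(ℝ, E) x), J x (J x v) = -v
  integrable : ∀ X Y : ∀ x : M, TangentSpace 𝓘(ℝ, E) x, SmoothVF X → SmoothVF Y →
    ∀ x, nijenhuis J X Y x = 0
  compatible : ∀ (x : M) (u v : TangentSpace 𝓘(ℝ, E) x),
    g.inner x (J x u) (J x v) = g.inner x u v

/-- The fundamental form `(u, v) ↦ g(u, J v)`. -/
def fundamentalForm (J : EndoField E M) (g : Metric E M) (x : M)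
    (u v : TangentSpace 𝓘(ℝ, E) x) : ℝ :=
  g.inner x u (J x v)

/-- `(J, g)` is a Vaisman structure with Lee form `θ`: it is Hermitian, the 1-form `θ` is nonzero
and parallel, and the fundamental form `Ω` satisfies `dΩ = θ ∧ Ω`. -/
structure IsVaisman (J : EndoField E M) (g : Metric E M) (θ : OneForm E M) : Prop
    extends IsHermitianStructure J g where
  nonzero : ∃ x, θ x ≠ 0
  parallel : IsParallel g θ
  lee : ∀ X Y Z : ∀ x : M, TangentSpace 𝓘(ℝ, E) x, SmoothVF X → SmoothVF Y → SmoothVF Z →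
    ∀ x, cartanTwo (fundamentalForm J g) X Y Z x
      = wedgeOneTwo θ (fundamentalForm J g) x (X x) (Y x) (Z x)

/-- The anti-Lee form `θᶜ = - θ ∘ J`. -/
def antiLee (J : EndoField E M) (θ : OneForm E M) (x : M) : TangentSpace 𝓘(ℝ, E) x →L[ℝ] ℝ :=
  -(θ x).comp (J x)

/-- The Lee field `U = θ^♯`. -/
def leeField (g : Metric E M) (θ : OneForm E M) (x : M) : TangentSpace 𝓘(ℝ, E) x :=
  sharp g x (θ x)

/-- The anti-Lee field `V = (θᶜ)^♯`. -/
def antiLeeField (J : EndoField E M) (g : Metric E M) (θ : OneForm E M) (x : M) :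
    TangentSpace 𝓘(ℝ, E) x :=
  sharp g x (antiLee J θ x)

/-- The tangent distribution of the canonical foliation, spanned by the Lee and anti-Lee
fields. -/
def canonicalFoliation (J : EndoField E M) (g : Metric E M) (θ : OneForm E M) (x : M) :
    Submodule ℝ (TangentSpace 𝓘(ℝ, E) x) :=
  Submodule.span ℝ {leeField g θ x, antiLeeField J g θ x}

/-- The 1-form `α` is basic for the distribution `D`: `α(X) = 0` and `Lie_X α = 0` for every
smooth vector field `X` tangent to `D`. -/
def IsBasic (D : ∀ x : M, Submodule ℝ (TangentSpace 𝓘(ℝ, E) x)) (α : OneForm E M) : Prop :=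
  ∀ X : ∀ x : M, TangentSpace 𝓘(ℝ, E) x, SmoothVF X → (∀ x, X x ∈ D x) →
    (∀ x, α x (X x) = 0) ∧
    ∀ Y : ∀ x : M, TangentSpace 𝓘(ℝ, E) x, SmoothVF Y →
      ∀ x, dirDeriv X (fun y => α y (Y y)) x - α x (bracket X Y x) = 0

end Vaisman

end

open Vaisman

noncomputable section
namespace Vaisman

variable {E : Type*} [NormedAddCommGroup E] [NormedSpace ℝ E] [FiniteDimensional ℝ E]
  {M : Type*} [TopologicalSpace M] [ChartedSpace E M] [IsManifold 𝓘(ℝ, E) ∞ M]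

open scoped Topology

set_option linter.unusedSectionVars false

/-! ### Smooth vector fields and functions -/

section VectorFields

variable {X Y Z : ∀ x : M, TangentSpace 𝓘(ℝ, E) x} {f h : M → ℝ}

/-! Write U for the Lee field, V = JU and ω for the fundamental form. Everything follows from the
invariance of the given tensors along U and V, with no analysis beyond smoothness.

Since θ is parallel, it is closed and U is Killing. Combined with dω = θ∧ω and the integrability of
J, this makes U holomorphic (`IsVaisman.bracket_leeField_endo`), and then V is holomorphic as well
(`IsVaisman.bracket_antiLeeField_endo`). In particular [U, V] = 0. A basic form ζ satisfies ι_X dζ =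
0 and L_X dζ = 0 for X tangent to the foliation.

Complex structure: J_t differs from J only by terms in U and V. Its Nijenhuis tensor therefore has
only U and V components, whose coefficients are the (1,1) conditions on dζ at (JX, Y) and (X, Y)
(`nijenhuis_deformedEndo`).

Metric: dζ(J·,·) is symmetric because dζ is of type (1,1). Splitting off the U and V components and
completing a square (`IsDeformationData.deformedForm_self`) reduces positivity to the lower bound on
dζ(Jv, v).

Lee form: the new fundamental form is ω + dζ − θ∧ζ (`IsDeformationData.deformedForm_endo_right`),
that is, ω plus the image of ζ under the twisted differential d − θ∧. That operator squares to zero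
because dθ = 0, so the equation dω = θ∧ω persists.

Parallelism: U is still dual to θ for g_t, and g_t is built from U-invariant tensors, so U is
Killing for g_t. A closed form with Killing dual is parallel (`isParallel_of_killing`). Finally J_t
U = V, so the foliation does not change. -/

lemma SmoothVF.mdiffAt (hX : SmoothVF X) (x : M) : MDiffAt (T% X) x :=
  hX.mdifferentiable (by simp) x

lemma SmoothVF.add (hX : SmoothVF X) (hY : SmoothVF Y) : SmoothVF (X + Y) :=
  ContMDiff.add_section hX hY

lemma SmoothVF.sub (hX : SmoothVF X) (hY : SmoothVF Y) : SmoothVF (X - Y) :=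
  ContMDiff.sub_section hX hY

lemma SmoothVF.neg (hX : SmoothVF X) : SmoothVF (-X) :=
  ContMDiff.neg_section hX

lemma SmoothVF.smul (hf : ContMDiff 𝓘(ℝ, E) 𝓘(ℝ) ∞ f) (hX : SmoothVF X) : SmoothVF (f • X) :=
  ContMDiff.smul_section hf hX

lemma SmoothVF.bracket (hX : SmoothVF X) (hY : SmoothVF Y) : SmoothVF (bracket X Y) := by
  have : IsManifold 𝓘(ℝ, E) (((⊤ : ℕ∞) : WithTop ℕ∞) + 1) M := ‹IsManifold 𝓘(ℝ, E) ∞ M›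
  have : IsManifold 𝓘(ℝ, E) (minSmoothness ℝ 2) M := by
    simp only [minSmoothness_of_isRCLikeNormedField]
    infer_instance
  exact ContDiff.mlieBracket_vectorField (m := ⊤) (n := ⊤) hX hY (by simp)

lemma SmoothVF.endo (J : EndoField E M) (hX : SmoothVF X) : SmoothVF (fun x => J x (X x)) :=
  ContMDiff.clm_bundle_apply (b := fun x : M => x) J.smooth hX

lemma OneForm.contMDiff_apply (α : OneForm E M) (hX : SmoothVF X) :
    ContMDiff 𝓘(ℝ, E) 𝓘(ℝ) ∞ (fun x => α x (X x)) := by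
  intro x
  have h1 := (α.smooth x).clm_bundle_apply
    (E₂ := fun _ : M => ℝ) (b := fun y : M => y) (hX x)
  exact (contMDiffAt_totalSpace.1 h1).2

lemma metric_contMDiff (g : Metric E M) (hX : SmoothVF X) (hY : SmoothVF Y) :
    ContMDiff 𝓘(ℝ, E) 𝓘(ℝ) ∞ (fun x => g.inner x (X x) (Y x)) := by
  intro x
  have h1 := (g.contMDiff x).clm_bundle_apply₂
    (E₃ := fun _ : M => ℝ) (b := fun y : M => y) (hX x) (hY x)
  exact (contMDiffAt_totalSpace.1 h1).2

/-- X f is the fibre component of the tangent map of f composed with X. -/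
lemma contMDiff_dirDeriv (hX : SmoothVF X) (hf : ContMDiff 𝓘(ℝ, E) 𝓘(ℝ) ∞ f) :
    ContMDiff 𝓘(ℝ, E) 𝓘(ℝ) ∞ (dirDeriv X f) := by
  have h := (hf.contMDiff_tangentMap (m := ∞) (by simp)).comp hX
  exact (contMDiff_snd_tangentBundle_modelSpace ℝ 𝓘(ℝ)).comp h

lemma dirDeriv_add (hf : ContMDiff 𝓘(ℝ, E) 𝓘(ℝ) ∞ f) (hh : ContMDiff 𝓘(ℝ, E) 𝓘(ℝ) ∞ h) (x : M) :
    dirDeriv X (f + h) x = dirDeriv X f x + dirDeriv X h x := by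
  simp [dirDeriv, mvfderiv_add (hf.mdifferentiable (by simp) x)
    (hh.mdifferentiable (by simp) x)]

lemma dirDeriv_sub (hf : ContMDiff 𝓘(ℝ, E) 𝓘(ℝ) ∞ f) (hh : ContMDiff 𝓘(ℝ, E) 𝓘(ℝ) ∞ h) (x : M) :
    dirDeriv X (f - h) x = dirDeriv X f x - dirDeriv X h x := by
  simp [dirDeriv, mvfderiv_sub (hf.mdifferentiable (by simp) x)
    (hh.mdifferentiable (by simp) x)]

lemma dirDeriv_neg (x : M) : dirDeriv X (fun y => - f y) x = - dirDeriv X f x := by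
  simp [dirDeriv, mvfderiv_fun_neg]

lemma dirDeriv_mul (hf : ContMDiff 𝓘(ℝ, E) 𝓘(ℝ) ∞ f) (hh : ContMDiff 𝓘(ℝ, E) 𝓘(ℝ) ∞ h) (x : M) :
    dirDeriv X (f * h) x = f x * dirDeriv X h x + h x * dirDeriv X f x := by
  simp [dirDeriv, mvfderiv_mul (hf.mdifferentiable (by simp) x)
    (hh.mdifferentiable (by simp) x)]

lemma dirDeriv_const (c : ℝ) (x : M) : dirDeriv X (fun _ => c) x = 0 := by
  simp [dirDeriv, mvfderiv_const]

lemma bracket_swap (X Y : ∀ x : M, TangentSpace 𝓘(ℝ, E) x) (x : M) :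
    bracket X Y x = - bracket Y X x := VectorField.mlieBracket_swap_apply

lemma bracket_add_right (hY : SmoothVF Y) (hZ : SmoothVF Z) (x : M) :
    bracket X (Y + Z) x = bracket X Y x + bracket X Z x :=
  VectorField.mlieBracket_add_right (hY.mdiffAt x) (hZ.mdiffAt x)

lemma bracket_smul_right (hf : ContMDiff 𝓘(ℝ, E) 𝓘(ℝ) ∞ f) (hY : SmoothVF Y) (x : M) :
    bracket X (f • Y) x = dirDeriv X f x • Y x + f x • bracket X Y x :=
  VectorField.mlieBracket_smul_right (hf.mdifferentiable (by simp) x) (hY.mdiffAt x)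

lemma bracket_jacobi (hX : SmoothVF X) (hY : SmoothVF Y) (hZ : SmoothVF Z) (x : M) :
    bracket X (bracket Y Z) x = bracket (bracket X Y) Z x + bracket Y (bracket X Z) x := by
  have : IsManifold 𝓘(ℝ, E) (minSmoothness ℝ 3) M := by
    simp only [minSmoothness_of_isRCLikeNormedField]
    infer_instance
  have h2 : minSmoothness ℝ 2 ≤ ∞ := by
    simp only [minSmoothness_of_isRCLikeNormedField]
    exact ENat.LEInfty.out
  exact VectorField.leibniz_identity_mlieBracket_apply ((hX x).of_le h2) ((hY x).of_le h2)
    ((hZ x).of_le h2)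

end VectorFields

/-! ### Extending tangent vectors to global smooth fields; brackets as commutators -/

section Extension

variable [T2Space M]

/-- Multiplying by a bump function globalises a local field. The Hermitian and Vaisman conditions
quantify over global smooth fields, so this is what makes them usable at a single point. -/
lemma exists_smoothVF_eventuallyEq {x : M} {X : ∀ x : M, TangentSpace 𝓘(ℝ, E) x} {u : Set M}
    (hu : u ∈ 𝓝 x) (hX : ContMDiffOn 𝓘(ℝ, E) 𝓘(ℝ, E).tangent ∞
      (fun x => (X x : TangentBundle 𝓘(ℝ, E) M)) u) :
    ∃ Y : ∀ x : M, TangentSpace 𝓘(ℝ, E) x, SmoothVF Y ∧ Y =ᶠ[𝓝 x] X := by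
  obtain ⟨φ, -, hφ⟩ := (SmoothBumpFunction.nhds_basis_tsupport (I := 𝓘(ℝ, E)) x).mem_iff.1
    (interior_mem_nhds.2 hu)
  refine ⟨(φ : M → ℝ) • X, ContMDiffOn.smul_section_of_tsupport φ.contMDiff.contMDiffOn
    isOpen_interior hφ (hX.mono interior_subset), ?_⟩
  filter_upwards [φ.eventuallyEq_one] with y hy
  change φ y • X y = X y
  rw [hy, Pi.one_apply, one_smul]

lemma exists_smoothVF_eq {x : M} (v : TangentSpace 𝓘(ℝ, E) x) :
    ∃ Y : ∀ x : M, TangentSpace 𝓘(ℝ, E) x, SmoothVF Y ∧ Y x = v := by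
  obtain ⟨s, hs, hX⟩ := FiberBundle.exists_contMDiffOn_extend 𝓘(ℝ, E) E (k := ∞) v
  obtain ⟨Y, hY, h⟩ := exists_smoothVF_eventuallyEq hs hX
  exact ⟨Y, hY, by rw [h.eq_of_nhds, FiberBundle.extend_apply_self]⟩

variable {X Y Z : ∀ x : M, TangentSpace 𝓘(ℝ, E) x} {f h : M → ℝ}

/-- The Lie bracket is the commutator of directional derivatives. -/
theorem dirDeriv_bracket (hX : SmoothVF X) (hY : SmoothVF Y) (hf : ContMDiff 𝓘(ℝ, E) 𝓘(ℝ) ∞ f)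
    (x : M) :
    dirDeriv (bracket X Y) f x = dirDeriv X (dirDeriv Y f) x - dirDeriv Y (dirDeriv X f) x := by
  -- The commutator formula is extracted from the Jacobi identity applied to X, Y and f • Z:
  -- comparing coefficients of Z at x gives it as soon as Z x ≠ 0. If the tangent space is zero,
  -- both sides vanish.
  by_cases hs : ∀ v : TangentSpace 𝓘(ℝ, E) x, v = 0
  · simp only [dirDeriv, hs (X x), hs (Y x), hs (bracket X Y x), map_zero, sub_zero]
  push Not at hs
  obtain ⟨v, hv⟩ := hs
  obtain ⟨Z, hZ, rfl⟩ := exists_smoothVF_eq v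
  have hXf := contMDiff_dirDeriv hX hf
  have hYf := contMDiff_dirDeriv hY hf
  have key : ∀ (A B : ∀ x : M, TangentSpace 𝓘(ℝ, E) x), SmoothVF A → SmoothVF B →
      bracket A (bracket B (f • Z)) x = dirDeriv A (dirDeriv B f) x • Z x
        + dirDeriv B f x • bracket A Z x + dirDeriv A f x • bracket B Z x
        + f x • bracket A (bracket B Z) x := by
    intro A B hA hB
    have e : bracket B (f • Z) = dirDeriv B f • Z + f • bracket B Z :=
      funext fun y => bracket_smul_right hf hZ y
    have hBf := contMDiff_dirDeriv hB hf
    rw [e, bracket_add_right (hZ.smul hBf) ((hB.bracket hZ).smul hf),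
      bracket_smul_right hBf hZ, bracket_smul_right hf (hB.bracket hZ)]
    module
  have h1 := bracket_jacobi hX hY (hZ.smul hf) x
  rw [key X Y hX hY, key Y X hY hX, bracket_smul_right hf hZ, bracket_jacobi hX hY hZ] at h1
  have h2 : (dirDeriv X (dirDeriv Y f) x - dirDeriv Y (dirDeriv X f) x
      - dirDeriv (bracket X Y) f x) • Z x = 0 := by
    rw [← sub_eq_zero] at h1
    rw [← h1]
    module
  rcases smul_eq_zero.1 h2 with h3 | h3
  · linarith
  · exact absurd h3 hv

end Extension

/-! ### Smoothness of tensor fields -/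

section Tensors

/-- In finite dimension an operator is the sum of the rank-one maps given by its values on a basis,
so smoothness of these values suffices. -/
lemma contMDiffAt_clm_of_apply {F : Type*} [NormedAddCommGroup F] [NormedSpace ℝ F]
    {A : M → E →L[ℝ] F} {x : M}
    (h : ∀ v, ContMDiffAt 𝓘(ℝ, E) 𝓘(ℝ, F) ∞ (fun y => A y v) x) :
    ContMDiffAt 𝓘(ℝ, E) 𝓘(ℝ, E →L[ℝ] F) ∞ A x := by
  let b := Module.finBasis ℝ E
  have e : A = fun y => ∑ i, ContinuousLinearMap.smulRightL ℝ E F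
      (LinearMap.toContinuousLinearMap (b.coord i)) (A y (b i)) := by
    ext y v
    conv_lhs => rw [← b.sum_repr v]
    simp [-Basis.sum_repr]
  rw [e]
  refine contMDiffAt_finsetSum fun i _ => ?_
  exact (ContinuousLinearMap.contMDiff _).contMDiffAt.comp x (h (b i))

variable [T2Space M] {F : Type*} [NormedAddCommGroup F] [NormedSpace ℝ F]
  {W : M → Type*} [TopologicalSpace (TotalSpace F W)] [∀ x, AddCommGroup (W x)]
  [∀ x, Module ℝ (W x)] [∀ x, TopologicalSpace (W x)] [FiberBundle F W] [VectorBundle ℝ F W]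
  [∀ x, IsTopologicalAddGroup (W x)] [∀ x, ContinuousSMul ℝ (W x)]

/-- A field of linear maps on the tangent bundle is smooth if it maps smooth vector fields to
smooth sections. -/
theorem contMDiff_hom_of_apply {A : ∀ x : M, TangentSpace 𝓘(ℝ, E) x →L[ℝ] W x}
    (h : ∀ X : ∀ x : M, TangentSpace 𝓘(ℝ, E) x, SmoothVF X →
      ContMDiff 𝓘(ℝ, E) (𝓘(ℝ, E).prod 𝓘(ℝ, F)) ∞ (fun x => TotalSpace.mk' F x (A x (X x)))) :
    ContMDiff 𝓘(ℝ, E) (𝓘(ℝ, E).prod 𝓘(ℝ, E →L[ℝ] F)) ∞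
      (fun x => TotalSpace.mk' (E →L[ℝ] F)
        (E := fun x : M => TangentSpace 𝓘(ℝ, E) x →L[ℝ] W x) x (A x)) := by
  intro x
  rw [contMDiffAt_hom_bundle]
  refine ⟨contMDiffAt_id, contMDiffAt_clm_of_apply fun v => ?_⟩
  let e := trivializationAt E (TangentSpace 𝓘(ℝ, E) : M → Type _) x
  -- The field that is constant v in the trivialization is smooth near x; a global field agreeing
  -- with it there turns the hypothesis into smoothness of the coordinate expression of A at v.
  have hs : ContMDiffOn 𝓘(ℝ, E) 𝓘(ℝ, E).tangent ∞
      (fun y => (⟨y, e.symm y v⟩ : TangentBundle 𝓘(ℝ, E) M)) e.baseSet := by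
    refine (e.contMDiffOn_section_baseSet_iff (IB := 𝓘(ℝ, E)) (n := ∞)
      (s := fun y => e.symm y v)).2 ?_
    refine (contMDiffOn_const (c := v)).congr fun y hy => ?_
    rw [e.apply_mk_symm hy]
  have hx : e.baseSet ∈ 𝓝 x := e.open_baseSet.mem_nhds (FiberBundle.mem_baseSet_trivializationAt' x)
  obtain ⟨Y, hY, hYe⟩ := exists_smoothVF_eventuallyEq hx hs
  have h1 := (contMDiffAt_section x).1 (h Y hY x)
  let e' := trivializationAt F W x
  have hx' : e'.baseSet ∈ 𝓝 x :=
    e'.open_baseSet.mem_nhds (FiberBundle.mem_baseSet_trivializationAt' x)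
  refine h1.congr_of_eventuallyEq ?_
  filter_upwards [hx, hx', hYe] with y hy hy' hYy
  simp only [ContinuousLinearMap.inCoordinates, ContinuousLinearMap.comp_apply]
  rw [hYy, Trivialization.continuousLinearMapAt_apply, Trivialization.linearMapAt_apply, if_pos hy', Trivialization.symmL_apply _ hy]

theorem contMDiff_oneForm_of_apply {α : ∀ x : M, TangentSpace 𝓘(ℝ, E) x →L[ℝ] ℝ}
    (h : ∀ X : ∀ x : M, TangentSpace 𝓘(ℝ, E) x, SmoothVF X →
      ContMDiff 𝓘(ℝ, E) 𝓘(ℝ) ∞ (fun x => α x (X x))) :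
    ContMDiff 𝓘(ℝ, E) (𝓘(ℝ, E).prod 𝓘(ℝ, E →L[ℝ] ℝ)) ∞
      (fun x => TotalSpace.mk' (E →L[ℝ] ℝ)
        (E := fun x : M => TangentSpace 𝓘(ℝ, E) x →L[ℝ] ℝ) x (α x)) :=
  contMDiff_hom_of_apply (W := fun _ : M => ℝ) fun X hX x =>
    contMDiffAt_totalSpace.2 ⟨contMDiffAt_id, h X hX x⟩

theorem contMDiff_bilin_of_apply
    {B : ∀ x : M, TangentSpace 𝓘(ℝ, E) x →L[ℝ] TangentSpace 𝓘(ℝ, E) x →L[ℝ] ℝ}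
    (h : ∀ X Y : ∀ x : M, TangentSpace 𝓘(ℝ, E) x, SmoothVF X → SmoothVF Y →
      ContMDiff 𝓘(ℝ, E) 𝓘(ℝ) ∞ (fun x => B x (X x) (Y x))) :
    ContMDiff 𝓘(ℝ, E) (𝓘(ℝ, E).prod 𝓘(ℝ, E →L[ℝ] E →L[ℝ] ℝ)) ∞
      (fun x => TotalSpace.mk' (E →L[ℝ] E →L[ℝ] ℝ)
        (E := fun x : M => TangentSpace 𝓘(ℝ, E) x →L[ℝ] TangentSpace 𝓘(ℝ, E) x →L[ℝ] ℝ)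
          x (B x)) :=
  contMDiff_hom_of_apply (W := fun x : M => TangentSpace 𝓘(ℝ, E) x →L[ℝ] ℝ) fun X hX =>
    contMDiff_oneForm_of_apply fun Y hY => h X Y hX hY

end Tensors

/-! ### Musical isomorphism, norm of a covector, boundedness of metric balls -/

section Sharp

lemma metric_nondegenerate (g : Metric E M) {x : M} {u : TangentSpace 𝓘(ℝ, E) x}
    (h : ∀ w, g.inner x u w = 0) : u = 0 :=
  inner_ext g fun w => by simp [h w]

lemma sharp_eq (g : Metric E M) {x : M} {α : TangentSpace 𝓘(ℝ, E) x →L[ℝ] ℝ}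
    {u : TangentSpace 𝓘(ℝ, E) x} (h : ∀ w, g.inner x u w = α w) : sharp g x α = u :=
  inner_ext g fun w => by rw [inner_sharp, h]

/-- The vector field dual to a smooth 1-form is smooth. -/
theorem smoothVF_sharp (g : Metric E M) (α : OneForm E M) :
    SmoothVF (fun x => sharp g x (α x)) := by
  intro x
  refine (contMDiffAt_section x).2 ?_
  let e := trivializationAt E (TangentSpace 𝓘(ℝ, E) : M → Type _) x
  let B : M → E →L[ℝ] E →L[ℝ] ℝ := fun y =>
    ContinuousLinearMap.inCoordinates E (TangentSpace 𝓘(ℝ, E) : M → Type _) (E →L[ℝ] ℝ)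
      (fun y : M => TangentSpace 𝓘(ℝ, E) y →L[ℝ] ℝ) x y x y (g.inner y)
  let a : M → E →L[ℝ] ℝ := fun y =>
    ContinuousLinearMap.inCoordinates E (TangentSpace 𝓘(ℝ, E) : M → Type _) ℝ
      (fun _ : M => ℝ) x y x y (α y)
  have hB : ContMDiffAt 𝓘(ℝ, E) 𝓘(ℝ, E →L[ℝ] E →L[ℝ] ℝ) ∞ B x :=
    (contMDiffAt_hom_bundle _).1 (g.contMDiff x) |>.2
  have ha : ContMDiffAt 𝓘(ℝ, E) 𝓘(ℝ, E →L[ℝ] ℝ) ∞ a x :=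
    (contMDiffAt_hom_bundle _).1 (α.smooth x) |>.2
  have hBa : ∀ y ∈ e.baseSet, ∀ v w, B y v w = g.inner y (e.symm y v) (e.symm y w) :=
    fun y hy v w => (inCoordinates_apply_eq₂ (F₃ := ℝ) (E₃ := fun _ : M => ℝ) hy hy
      (Set.mem_univ _)).trans (by simp; rfl)
  have haa : ∀ y ∈ e.baseSet, ∀ w, a y w = α y (e.symm y w) := by
    intro y hy w
    simp only [a, ContinuousLinearMap.inCoordinates, ContinuousLinearMap.comp_apply]
    rw [Trivialization.symmL_apply _ hy]
    simp
  have hsymm : ∀ y ∈ e.baseSet, ∀ u : TangentSpace 𝓘(ℝ, E) y, e.symm y (e ⟨y, u⟩).2 = u :=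
    fun y hy u => e.symm_apply_apply_mk hy u
  -- Nondegeneracy makes the Gram operator `B y` invertible throughout the base set. Hence `inverse`
  -- is a genuine inverse there, and smoothness of inversion applies at x.
  have hequiv : ∀ y ∈ e.baseSet, ∃ T : E ≃L[ℝ] (E →L[ℝ] ℝ), (T : E →L[ℝ] E →L[ℝ] ℝ) = B y := by
    intro y hy
    have hinj : Function.Injective (B y) := by
      refine (injective_iff_map_eq_zero _).2 fun v hv => ?_
      have h0 : e.symm y v = 0 := metric_nondegenerate g fun w => by
        rw [← hsymm y hy w, ← hBa y hy, hv, zero_apply]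
      have h1 := e.apply_mk_symm hy v
      rw [h0] at h1
      have h2 := congrArg Prod.snd (e.zeroSection ℝ hy)
      simp only [zeroSection] at h2
      rw [h1] at h2
      exact h2
    have hd : finrank ℝ E = finrank ℝ (E →L[ℝ] ℝ) := by
      rw [← (LinearMap.toContinuousLinearMap (𝕜 := ℝ) (E := E) (F' := ℝ)).finrank_eq]
      exact Subspace.dual_finrank_eq.symm
    refine ⟨(LinearEquiv.ofInjectiveOfFinrankEq (B y).toLinearMap hinj hd).toContinuousLinearEquiv,
      ?_⟩
    ext v w
    rfl
  have hx : e.baseSet ∈ 𝓝 x := e.open_baseSet.mem_nhds (FiberBundle.mem_baseSet_trivializationAt' x)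
  have hinv : ContMDiffAt 𝓘(ℝ, E) 𝓘(ℝ, E) ∞ (fun y => (B y).inverse (a y)) x := by
    obtain ⟨T, hT⟩ := hequiv x (FiberBundle.mem_baseSet_trivializationAt' x)
    have h1 : ContMDiffAt 𝓘(ℝ, E) 𝓘(ℝ, (E →L[ℝ] ℝ) →L[ℝ] E) ∞
        (fun y => (B y).inverse) x := by
      have h2 := contDiffAt_map_inverse (n := ∞) T
      rw [hT] at h2
      exact h2.contMDiffAt.comp x hB
    exact h1.clm_apply ha
  refine hinv.congr_of_eventuallyEq ?_
  filter_upwards [hx] with y hy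
  obtain ⟨T, hT⟩ := hequiv y hy
  change (e ⟨y, sharp g y (α y)⟩).2 = _
  rw [← hT, ContinuousLinearMap.inverse_equiv, ContinuousLinearEquiv.coe_coe,
    ContinuousLinearEquiv.eq_symm_apply]
  ext w
  rw [← ContinuousLinearEquiv.coe_coe, hT, hBa y hy, haa y hy, hsymm y hy, inner_sharp]

/-- In an orthonormal frame the dual vector is Σ α(e_i) e_i, so |α|² = α(α^♯). This removes the
chosen frame from the norm. -/
lemma normOne_eq_sqrt (g : Metric E M) (x : M) (α : TangentSpace 𝓘(ℝ, E) x →L[ℝ] ℝ) :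
    normOne g x α = Real.sqrt (α (sharp g x α)) := by
  have hb : ∀ i j, g.inner x (orthonormalFrame g x i) (orthonormalFrame g x j)
      = if i = j then 1 else 0 := (exists_orthonormal g x).choose_spec
  have hs : sharp g x α = ∑ i, α (orthonormalFrame g x i) • orthonormalFrame g x i := by
    refine sharp_eq g fun w => ?_
    rw [← (orthonormalFrame g x).sum_repr w]
    simp [-Basis.sum_repr, hb, map_sum]
  rw [normOne]
  congr 1
  rw [hs, map_sum]
  refine Finset.sum_congr rfl fun i _ => ?_
  rw [map_smul, smul_eq_mul, sq]

/-- By compactness of the unit sphere, B v v ≥ m ‖v‖² with m > 0 the minimum there, so the B-unit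
ball is bounded. This supplies the boundedness field of a Riemannian metric. -/
lemma isVonNBounded_of_posDef {F : Type*} [NormedAddCommGroup F] [NormedSpace ℝ F]
    [FiniteDimensional ℝ F] (B : F →L[ℝ] F →L[ℝ] ℝ) (hB : ∀ v, v ≠ 0 → 0 < B v v) :
    Bornology.IsVonNBounded ℝ {v : F | B v v < 1} := by
  have : ProperSpace F := FiniteDimensional.proper ℝ F
  rw [NormedSpace.isVonNBounded_iff]
  by_cases hne : (Metric.sphere (0 : F) 1).Nonempty
  · have hc : ContinuousOn (fun v => B v v) (Metric.sphere (0 : F) 1) :=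
      (B.continuous.clm_apply continuous_id).continuousOn
    obtain ⟨v₀, hv₀, hmin⟩ := (isCompact_sphere (0 : F) 1).exists_isMinOn hne hc
    have h0 : 0 < B v₀ v₀ := hB v₀ (by
      rintro rfl
      simp at hv₀)
    refine (Metric.isBounded_closedBall (x := (0 : F)) (r := Real.sqrt (1 / B v₀ v₀))).subset ?_
    intro v hv
    rw [mem_closedBall_zero_iff]
    by_cases hv0 : v = 0
    · simp [hv0]
    have hn : 0 < ‖v‖ := norm_pos_iff.2 hv0
    have hm := hmin (show ‖v‖⁻¹ • v ∈ Metric.sphere (0 : F) 1 by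
      rw [mem_sphere_zero_iff_norm, norm_smul, norm_inv, norm_norm, inv_mul_cancel₀ hn.ne'])
    simp only [Set.mem_ofPred_eq, map_smul, smul_apply, smul_eq_mul] at hm hv
    refine Real.le_sqrt_of_sq_le ?_
    rw [le_div_iff₀ h0]
    have h2 : ‖v‖ ^ 2 * B v₀ v₀ ≤ ‖v‖ ^ 2 * (‖v‖⁻¹ * (‖v‖⁻¹ * B v v)) := by gcongr
    have h3 : ‖v‖ ^ 2 * (‖v‖⁻¹ * (‖v‖⁻¹ * B v v)) = B v v := by field_simp
    linarith
  -- An empty unit sphere forces F to be zero.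
  · refine Bornology.isBounded_singleton (x := (0 : F)) |>.subset fun v _ => ?_
    by_contra hv
    refine hne ⟨‖v‖⁻¹ • v, ?_⟩
    rw [mem_sphere_zero_iff_norm, norm_smul, norm_inv, norm_norm,
      inv_mul_cancel₀ (norm_ne_zero_iff.2 hv)]

end Sharp

/-! ### The exterior derivative on smooth fields -/

section ExteriorDerivative

variable {X Y Z : ∀ x : M, TangentSpace 𝓘(ℝ, E) x} (α : OneForm E M)

lemma extD_eq (hX : SmoothVF X) (hY : SmoothVF Y) (x : M) :
    extD α x (X x) (Y x) = dirDeriv X (fun y => α y (Y y)) x - dirDeriv Y (fun y => α y (X y)) x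
      - α x (bracket X Y x) :=
  extD_apply α (hX.mdiffAt x) (hY.mdiffAt x)

lemma contMDiff_extD_apply (hX : SmoothVF X) (hY : SmoothVF Y) :
    ContMDiff 𝓘(ℝ, E) 𝓘(ℝ) ∞ (fun x => extD α x (X x) (Y x)) := by
  rw [funext fun x => extD_eq α hX hY x]
  exact ((contMDiff_dirDeriv hX (α.contMDiff_apply hY)).sub
    (contMDiff_dirDeriv hY (α.contMDiff_apply hX))).sub (α.contMDiff_apply (hX.bracket hY))

variable [T2Space M]

lemma extD_swap (x : M) (u v : TangentSpace 𝓘(ℝ, E) x) : extD α x u v = - extD α x v u := by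
  obtain ⟨X, hX, rfl⟩ := exists_smoothVF_eq u
  obtain ⟨Y, hY, rfl⟩ := exists_smoothVF_eq v
  rw [extD_apply α (hX.mdiffAt x) (hY.mdiffAt x), extD_apply α (hY.mdiffAt x) (hX.mdiffAt x),
    cartanOne_swap]

/-- The exterior derivative squares to zero. -/
theorem cartanTwo_extD (hX : SmoothVF X) (hY : SmoothVF Y) (hZ : SmoothVF Z) (x : M) :
    cartanTwo (fun y u v => extD α y u v) X Y Z x = 0 := by
  have expand : ∀ {A B C : ∀ x : M, TangentSpace 𝓘(ℝ, E) x}, SmoothVF A → SmoothVF B →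
      SmoothVF C → dirDeriv A (fun y => extD α y (B y) (C y)) x
        = dirDeriv A (dirDeriv B fun y => α y (C y)) x - dirDeriv A (dirDeriv C fun y => α y (B y)) x
          - dirDeriv A (fun y => α y (bracket B C y)) x := by
    intro A B C hA hB hC
    have h1 := contMDiff_dirDeriv hB (α.contMDiff_apply hC)
    have h2 := contMDiff_dirDeriv hC (α.contMDiff_apply hB)
    rw [funext fun y => extD_eq α hB hC y]
    refine (dirDeriv_sub (h1.sub h2) (α.contMDiff_apply (hB.bracket hC)) x).trans ?_
    exact congrArg (· - dirDeriv A (fun y => α y (bracket B C y)) x) (dirDeriv_sub h1 h2 x)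
  -- Once second derivatives are replaced by commutators, the only surviving terms are α on iterated
  -- brackets, and these cancel by Jacobi.
  have j := congrArg (α x) (bracket_jacobi hX hY hZ x)
  rw [bracket_swap Y (bracket X Z), map_add, map_neg] at j
  rw [bracket_swap X (bracket Y Z), map_neg] at j
  simp only [cartanTwo]
  rw [expand hX hY hZ, expand hY hX hZ, expand hZ hX hY, extD_eq α (hX.bracket hY) hZ,
    extD_eq α (hX.bracket hZ) hY, extD_eq α (hY.bracket hZ) hX,
    dirDeriv_bracket hX hY (α.contMDiff_apply hZ), dirDeriv_bracket hX hZ (α.contMDiff_apply hY),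
    dirDeriv_bracket hY hZ (α.contMDiff_apply hX)]
  linarith

end ExteriorDerivative

/-! ### Parallel 1-forms -/

section Parallel

variable [T2Space M] {X Y Z : ∀ x : M, TangentSpace 𝓘(ℝ, E) x} {g : Metric E M} {θ : OneForm E M}

lemma smoothVF_leeField (g : Metric E M) (θ : OneForm E M) : SmoothVF (leeField g θ) :=
  smoothVF_sharp g θ

lemma inner_leeField (g : Metric E M) (θ : OneForm E M) (x : M) (v : TangentSpace 𝓘(ℝ, E) x) :
    g.inner x (leeField g θ x) v = θ x v := inner_sharp g x _ v

lemma torsion_free (g : Metric E M) (hX : SmoothVF X) (hY : SmoothVF Y) (x : M) :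
    leviCivita g Y x (X x) - leviCivita g X x (Y x) = bracket X Y x :=
  (CovariantDerivative.torsion_eq_zero_iff _).1 (leviCivita_torsion g)
    (hX.mdiffAt x) (hY.mdiffAt x)

/-- Metric compatibility gives g(∇_X U, Y) = X(θ Y) − θ(∇_X Y), which is zero. -/
lemma IsParallel.leviCivita_leeField (h : IsParallel g θ) (x : M) (v : TangentSpace 𝓘(ℝ, E) x) :
    leviCivita g (leeField g θ) x v = 0 := by
  refine metric_nondegenerate g fun w => ?_
  obtain ⟨X, hX, rfl⟩ := exists_smoothVF_eq v
  obtain ⟨Y, hY, rfl⟩ := exists_smoothVF_eq w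
  have h1 := leviCivita_metric g (hX.mdiffAt x) ((smoothVF_leeField g θ).mdiffAt x) (hY.mdiffAt x)
  have h2 := h Y hY x (X x)
  simp only [inner_leeField] at h1
  rw [dirDeriv, h2] at h1
  linarith

/-- For a torsion-free connection dθ is the antisymmetrization of ∇θ. -/
lemma IsParallel.extD_eq_zero (h : IsParallel g θ) (x : M) (u v : TangentSpace 𝓘(ℝ, E) x) :
    extD θ x u v = 0 := by
  obtain ⟨X, hX, rfl⟩ := exists_smoothVF_eq u
  obtain ⟨Y, hY, rfl⟩ := exists_smoothVF_eq v
  rw [extD_eq θ hX hY, dirDeriv, dirDeriv, h Y hY, h X hX, ← torsion_free g hX hY, map_sub]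
  ring

/-- The field dual to a parallel 1-form is Killing. -/
lemma IsParallel.killing (h : IsParallel g θ) (hY : SmoothVF Y) (hZ : SmoothVF Z) (x : M) :
    dirDeriv (leeField g θ) (fun y => g.inner y (Y y) (Z y)) x
      = g.inner x (bracket (leeField g θ) Y x) (Z x)
        + g.inner x (Y x) (bracket (leeField g θ) Z x) := by
  have hU := smoothVF_leeField g θ
  rw [leviCivita_metric g (hU.mdiffAt x) (hY.mdiffAt x) (hZ.mdiffAt x), ← torsion_free g hU hY,
    ← torsion_free g hU hZ, h.leviCivita_leeField, h.leviCivita_leeField, sub_zero, sub_zero]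

/-- A closed 1-form whose dual field is Killing is parallel. -/
theorem isParallel_of_killing (hd : ∀ x u v, extD θ x u v = 0)
    (hk : ∀ Y Z : ∀ x : M, TangentSpace 𝓘(ℝ, E) x, SmoothVF Y → SmoothVF Z → ∀ x,
      dirDeriv (leeField g θ) (fun y => g.inner y (Y y) (Z y)) x
        = g.inner x (bracket (leeField g θ) Y x) (Z x)
          + g.inner x (Y x) (bracket (leeField g θ) Z x)) : IsParallel g θ := by
  intro Y hY x v
  obtain ⟨X, hX, rfl⟩ := exists_smoothVF_eq v
  have hU := smoothVF_leeField g θ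
  -- In Koszul's formula with third field U, the Killing equation cancels the brackets with U and
  -- leaves X(θ Y) + Y(θ X) + θ[X, Y]. Closedness turns this into 2 X(θ Y).
  have h1 := leviCivita_koszul g (hX.mdiffAt x) (hY.mdiffAt x) (hU.mdiffAt x)
  have h2 := hk X Y hX hY x
  have h3 := hd x (X x) (Y x)
  rw [extD_eq θ hX hY] at h3
  have e : ∀ A : ∀ x : M, TangentSpace 𝓘(ℝ, E) x,
      (fun y => g.inner y (A y) (leeField g θ y)) = fun y => θ y (A y) := fun A =>
    funext fun y => by rw [g.symm, inner_leeField]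
  have e' : ∀ A : ∀ x : M, TangentSpace 𝓘(ℝ, E) x,
      (fun y => g.inner y (leeField g θ y) (A y)) = fun y => θ y (A y) := fun A =>
    funext fun y => inner_leeField g θ y _
  have e'' : ∀ w : TangentSpace 𝓘(ℝ, E) x, g.inner x w (leeField g θ x) = θ x w := fun w => by
    rw [g.symm, inner_leeField]
  rw [koszul, e, e', h2, e'', e'', bracket_swap X (leeField g θ), bracket_swap Y (leeField g θ)] at h1
  have h4 := g.symm x (X x) (bracket (leeField g θ) Y x)
  change dirDeriv X (fun y => θ y (Y y)) x = _
  simp only [map_neg, neg_apply] at h1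
  linarith

end Parallel

/-! ### Vaisman structures -/

lemma bracket_neg_right {X Y : ∀ x : M, TangentSpace 𝓘(ℝ, E) x} (hY : SmoothVF Y) (x : M) :
    bracket X (-Y) x = - bracket X Y x := by
  have h := VectorField.mlieBracket_const_smul_right (c := (-1 : ℝ)) (V := X) (hY.mdiffAt x)
  rwa [neg_one_smul, neg_one_smul] at h

section VaismanStructure

variable [T2Space M] {X Y Z : ∀ x : M, TangentSpace 𝓘(ℝ, E) x}
  {J : EndoField E M} {g : Metric E M} {θ : OneForm E M}

lemma IsHermitianStructure.inner_endo_right (h : IsHermitianStructure J g) (x : M)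
    (u v : TangentSpace 𝓘(ℝ, E) x) : g.inner x u (J x v) = - g.inner x (J x u) v := by
  rw [← h.compatible x u (J x v), h.sq, (g.inner x (J x u)).map_neg]

lemma IsHermitianStructure.antiLeeField_eq (h : IsHermitianStructure J g) (θ : OneForm E M)
    (x : M) : antiLeeField J g θ x = J x (leeField g θ x) := by
  refine sharp_eq g fun w => ?_
  change _ = -θ x (J x w)
  rw [← inner_leeField g θ, h.inner_endo_right, neg_neg]

lemma IsHermitianStructure.endo_antiLeeField (h : IsHermitianStructure J g) (θ : OneForm E M)
    (x : M) : J x (antiLeeField J g θ x) = - leeField g θ x := by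
  rw [h.antiLeeField_eq, h.sq]

lemma IsHermitianStructure.smoothVF_antiLeeField (h : IsHermitianStructure J g) (θ : OneForm E M) :
    SmoothVF (antiLeeField J g θ) := by
  rw [funext (h.antiLeeField_eq θ)]
  exact (smoothVF_leeField g θ).endo J

lemma IsHermitianStructure.apply_antiLeeField (h : IsHermitianStructure J g) (θ : OneForm E M)
    (x : M) : θ x (antiLeeField J g θ x) = 0 := by
  have h1 := h.inner_endo_right x (leeField g θ x) (leeField g θ x)
  rw [g.symm x (J x _)] at h1
  rw [h.antiLeeField_eq, ← inner_leeField g θ]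
  linarith

/-- Cartan's formula L_U ω = d(ι_U ω) + ι_U dω, with ι_U ω = θ∘J and dω = θ∧ω. The left side is L_U
ω because U is Killing, so only L_U J contributes. -/
lemma IsVaisman.inner_lieDeriv_endo (h : IsVaisman J g θ) (hY : SmoothVF Y) (hZ : SmoothVF Z)
    (x : M) :
    g.inner x (Y x) (bracket (leeField g θ) (fun y => J y (Z y)) x
        - J x (bracket (leeField g θ) Z x))
      = dirDeriv Y (fun y => θ y (J y (Z y))) x - dirDeriv Z (fun y => θ y (J y (Y y))) x
        - θ x (J x (bracket Y Z x)) + θ x (leeField g θ x) * g.inner x (Y x) (J x (Z x))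
        - θ x (Y x) * θ x (J x (Z x)) + θ x (Z x) * θ x (J x (Y x)) := by
  have hU := smoothVF_leeField g θ
  have h1 := h.lee _ _ _ hU hY hZ x
  have h2 := h.parallel.killing hY (hZ.endo J) x
  simp only [cartanTwo, wedgeOneTwo, fundamentalForm, inner_leeField] at h1
  rw [h.inner_endo_right x (bracket Y Z x), g.symm x (J x (bracket Y Z x)),
    inner_leeField, h.inner_endo_right x (bracket _ Z x), g.symm x (J x _)] at h1
  rw [map_sub]
  linarith

/-- The Lee field of a Vaisman structure is holomorphic. -/
theorem IsVaisman.bracket_leeField_endo (h : IsVaisman J g θ) (hZ : SmoothVF Z) (x : M) :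
    bracket (leeField g θ) (fun y => J y (Z y)) x = J x (bracket (leeField g θ) Z x) := by
  rw [← sub_eq_zero]
  refine metric_nondegenerate g fun w => ?_
  obtain ⟨Y, hY, rfl⟩ := exists_smoothVF_eq w
  rw [g.symm]
  have sq : ∀ A : ∀ x : M, TangentSpace 𝓘(ℝ, E) x, (fun y => J y (J y (A y))) = -A := fun A =>
    funext fun y => h.sq y (A y)
  -- Compare the formula for g(Y, (L_U J)Z) at (Y, Z) and at (JY, JZ). The right side is of type
  -- (1,1): for d(θ∘J) this uses dθ = 0 and integrability (`h3`, `h4`, `h5`). The left side changes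
  -- sign because L_U J anticommutes with J. Hence both vanish.
  have h1 := h.inner_lieDeriv_endo hY hZ x
  have h2 := h.inner_lieDeriv_endo (hY.endo J) (hZ.endo J) x
  have h3 := h.parallel.extD_eq_zero x (J x (Y x)) (Z x)
  have h4 := h.parallel.extD_eq_zero x (Y x) (J x (Z x))
  rw [extD_eq θ (hY.endo J) hZ] at h3
  rw [extD_eq θ hY (hZ.endo J)] at h4
  have h5 := congrArg (fun v => θ x (J x v)) (h.integrable Y Z hY hZ x)
  simp only [nijenhuis, map_add, map_sub, h.sq, map_neg, map_zero] at h5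
  rw [sq, bracket_neg_right hZ] at h2
  simp only [h.sq, map_neg, map_sub, dirDeriv_neg] at h1 h2
  simp only [h.inner_endo_right x (Y x)] at h1
  rw [h.compatible] at h2
  rw [map_sub, h.inner_endo_right x (Y x) (bracket _ Z x)]
  linarith

/-- The anti-Lee field of a Vaisman structure is holomorphic. -/
theorem IsVaisman.bracket_antiLeeField_endo (h : IsVaisman J g θ) (hZ : SmoothVF Z) (x : M) :
    bracket (antiLeeField J g θ) (fun y => J y (Z y)) x
      = J x (bracket (antiLeeField J g θ) Z x) := by
  -- Since L_U J = 0, the Nijenhuis tensor at (U, Z) collapses to [V, JZ] − J[V, Z].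
  have h1 := h.integrable _ Z (smoothVF_leeField g θ) hZ x
  rw [nijenhuis, ← funext (h.antiLeeField_eq θ), h.bracket_leeField_endo hZ] at h1
  rw [← sub_eq_zero, ← h1]
  abel

lemma apply_leeField_of_normOne (hθ : ∀ x, normOne g x (θ x) = 1) (x : M) :
    θ x (leeField g θ x) = 1 := by
  have h := hθ x
  rwa [normOne_eq_sqrt, Real.sqrt_eq_one] at h

/-- L_U θ = d(θ(U)) + ι_U dθ vanishes because θ(U) is the constant 1 and θ is closed. -/
lemma IsVaisman.dirDeriv_leeField (h : IsVaisman J g θ) (hθ : ∀ x, normOne g x (θ x) = 1)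
    (hY : SmoothVF Y) (x : M) :
    dirDeriv (leeField g θ) (fun y => θ y (Y y)) x = θ x (bracket (leeField g θ) Y x) := by
  have h1 := h.parallel.extD_eq_zero x (leeField g θ x) (Y x)
  rw [extD_eq θ (smoothVF_leeField g θ) hY, funext (apply_leeField_of_normOne hθ),
    dirDeriv_const] at h1
  linarith

lemma antiLee_apply (J : EndoField E M) (θ : OneForm E M) (x : M) (v : TangentSpace 𝓘(ℝ, E) x) :
    antiLee J θ x v = - θ x (J x v) := rfl

lemma contMDiff_antiLee_apply (J : EndoField E M) (θ : OneForm E M) (hX : SmoothVF X) :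
    ContMDiff 𝓘(ℝ, E) 𝓘(ℝ) ∞ (fun x => antiLee J θ x (X x)) :=
  (θ.contMDiff_apply (hX.endo J)).neg

lemma IsVaisman.dirDeriv_leeField_antiLee (h : IsVaisman J g θ)
    (hθ : ∀ x, normOne g x (θ x) = 1) (hY : SmoothVF Y) (x : M) :
    dirDeriv (leeField g θ) (fun y => antiLee J θ y (Y y)) x
      = antiLee J θ x (bracket (leeField g θ) Y x) := by
  simp only [antiLee_apply]
  rw [dirDeriv_neg, h.dirDeriv_leeField hθ (hY.endo J), h.bracket_leeField_endo hY]

end VaismanStructure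

/-! ### Basic forms -/

section Basic

variable [T2Space M] {X Y Z : ∀ x : M, TangentSpace 𝓘(ℝ, E) x}
  {D : ∀ x : M, Submodule ℝ (TangentSpace 𝓘(ℝ, E) x)} {ζ : OneForm E M}

lemma IsBasic.dirDeriv_eq (h : IsBasic D ζ) (hX : SmoothVF X) (hXD : ∀ x, X x ∈ D x)
    (hY : SmoothVF Y) (x : M) :
    dirDeriv X (fun y => ζ y (Y y)) x = ζ x (bracket X Y x) :=
  sub_eq_zero.1 ((h X hX hXD).2 Y hY x)

/-- ι_X dζ = L_X ζ − d(ζ(X)), and both terms vanish for a basic form. -/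
lemma IsBasic.extD_eq_zero (h : IsBasic D ζ) (hX : SmoothVF X) (hXD : ∀ x, X x ∈ D x) (x : M)
    (v : TangentSpace 𝓘(ℝ, E) x) : extD ζ x (X x) v = 0 := by
  obtain ⟨Y, hY, rfl⟩ := exists_smoothVF_eq v
  rw [extD_eq ζ hX hY, h.dirDeriv_eq hX hXD hY, funext (h X hX hXD).1, dirDeriv_const]
  ring

lemma IsBasic.extD_eq_zero_right (h : IsBasic D ζ) (hX : SmoothVF X) (hXD : ∀ x, X x ∈ D x)
    (x : M) (v : TangentSpace 𝓘(ℝ, E) x) : extD ζ x v (X x) = 0 := by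
  rw [extD_swap, h.extD_eq_zero hX hXD, neg_zero]

/-- The exterior derivative of a basic form is invariant along the foliation. -/
lemma IsBasic.dirDeriv_extD (h : IsBasic D ζ) (hX : SmoothVF X) (hXD : ∀ x, X x ∈ D x)
    (hY : SmoothVF Y) (hZ : SmoothVF Z) (x : M) :
    dirDeriv X (fun y => extD ζ y (Y y) (Z y)) x
      = extD ζ x (bracket X Y x) (Z x) + extD ζ x (Y x) (bracket X Z x) := by
  -- L_X dζ = d(ι_X dζ) + ι_X d(dζ): the first term vanishes because dζ is horizontal, the second
  -- because d² = 0.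
  have h1 := cartanTwo_extD ζ hX hY hZ x
  simp only [cartanTwo, h.extD_eq_zero hX hXD, h.extD_eq_zero_right hX hXD, dirDeriv_const] at h1
  rw [extD_swap ζ x (Y x)]
  linarith

end Basic

/-! ### The deformed complex structure -/

section DeformedEndo

variable [T2Space M]

/-- The field of endomorphisms `J - U ⊗ ζ - V ⊗ (ζ ∘ J)`. -/
def deformedEndo (J : EndoField E M) {U V : ∀ x : M, TangentSpace 𝓘(ℝ, E) x} (hU : SmoothVF U)
    (hV : SmoothVF V) (ζ : OneForm E M) : EndoField E M where
  toFun x := J x - (ζ x).smulRight (U x) - ((ζ x).comp (J x)).smulRight (V x)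
  smooth := contMDiff_hom_of_apply (W := (TangentSpace 𝓘(ℝ, E) : M → Type _)) fun _ hX =>
    ((hX.endo J).sub (hU.smul (ζ.contMDiff_apply hX))).sub
      (hV.smul (ζ.contMDiff_apply (hX.endo J)))

variable {X Y Z U V : ∀ x : M, TangentSpace 𝓘(ℝ, E) x} {J : EndoField E M} {ζ : OneForm E M}

lemma deformedEndo_apply (hU : SmoothVF U) (hV : SmoothVF V) (x : M)
    (v : TangentSpace 𝓘(ℝ, E) x) :
    deformedEndo J hU hV ζ x v = J x v - ζ x v • U x - ζ x (J x v) • V x := rfl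

lemma bracket_smul_add_smul_right {a b : M → ℝ} (hU : SmoothVF U) (hV : SmoothVF V)
    (ha : ContMDiff 𝓘(ℝ, E) 𝓘(ℝ) ∞ a) (hb : ContMDiff 𝓘(ℝ, E) 𝓘(ℝ) ∞ b) (x : M) :
    bracket X (a • U + b • V) x
      = dirDeriv X a x • U x + a x • bracket X U x + (dirDeriv X b x • V x + b x • bracket X V x) := by
  rw [bracket_add_right (hU.smul ha) (hV.smul hb), bracket_smul_right ha hU,
    bracket_smul_right hb hV]

lemma bracket_sub_right (hY : SmoothVF Y) (hZ : SmoothVF Z) (x : M) :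
    bracket X (Y - Z) x = bracket X Y x - bracket X Z x := by
  rw [sub_eq_add_neg, bracket_add_right hY hZ.neg, bracket_neg_right hZ, sub_eq_add_neg]

lemma bracket_sub_left (hX : SmoothVF X) (hZ : SmoothVF Z) (x : M) :
    bracket (X - Z) Y x = bracket X Y x - bracket Z Y x := by
  rw [bracket_swap, bracket_sub_right hX hZ, bracket_swap X, bracket_swap Z]
  abel

lemma dirDeriv_smul_add_smul {a b f : M → ℝ} (x : M) :
    dirDeriv (a • U + b • V) f x = a x * dirDeriv U f x + b x * dirDeriv V f x := by
  simp [dirDeriv]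

/-- Let `U` and `V = J U` be commuting holomorphic fields for an integrable almost complex
structure `J`. If `ζ` is basic for the foliation that they span and `dζ` is of type `(1,1)`, then
`J - U ⊗ ζ - V ⊗ (ζ ∘ J)` is integrable. -/
theorem nijenhuis_deformedEndo (hU : SmoothVF U) (hV : SmoothVF V)
    (sq : ∀ (x : M) (v : TangentSpace 𝓘(ℝ, E) x), J x (J x v) = -v)
    (hN : ∀ X Y : ∀ x : M, TangentSpace 𝓘(ℝ, E) x, SmoothVF X → SmoothVF Y →
      ∀ x, nijenhuis J X Y x = 0)
    (hJU : ∀ x, J x (U x) = V x)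
    (hLU : ∀ Y, SmoothVF Y → ∀ x, bracket U (fun y => J y (Y y)) x = J x (bracket U Y x))
    (hLV : ∀ Y, SmoothVF Y → ∀ x, bracket V (fun y => J y (Y y)) x = J x (bracket V Y x))
    (hζU : ∀ x, ζ x (U x) = 0) (hζV : ∀ x, ζ x (V x) = 0)
    (hζLU : ∀ Y, SmoothVF Y → ∀ x, dirDeriv U (fun y => ζ y (Y y)) x = ζ x (bracket U Y x))
    (hζLV : ∀ Y, SmoothVF Y → ∀ x, dirDeriv V (fun y => ζ y (Y y)) x = ζ x (bracket V Y x))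
    (htype : ∀ (x : M) (u v : TangentSpace 𝓘(ℝ, E) x),
      extD ζ x (J x u) (J x v) = extD ζ x u v)
    (hX : SmoothVF X) (hY : SmoothVF Y) (x : M) :
    nijenhuis (deformedEndo J hU hV ζ) X Y x = 0 := by
  have hJV : ∀ x, J x (V x) = - U x := fun x => by rw [← hJU, sq]
  have hUV : bracket U V x = 0 := by
    rw [← funext hJU, hLU U hU]
    simp [bracket]
  have hVU : bracket V U x = 0 := by rw [bracket_swap, hUV, neg_zero]
  have hUU : bracket U U x = 0 := by simp [bracket]
  have hVV : bracket V V x = 0 := by simp [bracket]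
  let a : ∀ Z : ∀ x : M, TangentSpace 𝓘(ℝ, E) x, M → ℝ := fun Z y => ζ y (Z y)
  let b : ∀ Z : ∀ x : M, TangentSpace 𝓘(ℝ, E) x, M → ℝ := fun Z y => ζ y (J y (Z y))
  have ha : ∀ {Z}, SmoothVF Z → ContMDiff 𝓘(ℝ, E) 𝓘(ℝ) ∞ (a Z) := fun hZ => ζ.contMDiff_apply hZ
  have hb : ∀ {Z}, SmoothVF Z → ContMDiff 𝓘(ℝ, E) 𝓘(ℝ) ∞ (b Z) := fun hZ =>
    ζ.contMDiff_apply (hZ.endo J)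
  -- `P` is the correction in J_t = J − P. It takes values in the span of U and V, whose mutual
  -- brackets vanish.
  let P : (∀ x : M, TangentSpace 𝓘(ℝ, E) x) → ∀ x : M, TangentSpace 𝓘(ℝ, E) x := fun Z =>
    a Z • U + b Z • V
  have hP : ∀ {Z}, SmoothVF Z → SmoothVF (P Z) := fun hZ =>
    (hU.smul (ha hZ)).add (hV.smul (hb hZ))
  have hJt : ∀ Z : ∀ x : M, TangentSpace 𝓘(ℝ, E) x,
      (fun y => deformedEndo J hU hV ζ y (Z y)) = (fun y => J y (Z y)) - P Z := by
    intro Z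
    funext y
    rw [deformedEndo_apply, sub_sub]
    rfl
  have hJX := hX.endo J
  have hJY := hY.endo J
  have hPr : ∀ {Z W : ∀ x : M, TangentSpace 𝓘(ℝ, E) x}, SmoothVF Z →
      bracket W (P Z) x = dirDeriv W (a Z) x • U x + a Z x • bracket W U x
        + (dirDeriv W (b Z) x • V x + b Z x • bracket W V x) := fun hZ =>
    bracket_smul_add_smul_right hU hV (ha hZ) (hb hZ) x
  have hPJ : ∀ {Z W : ∀ x : M, TangentSpace 𝓘(ℝ, E) x}, SmoothVF Z → SmoothVF W →
      bracket (fun y => J y (W y)) (P Z) x = dirDeriv (fun y => J y (W y)) (a Z) x • U x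
        - a Z x • J x (bracket U W x)
        + (dirDeriv (fun y => J y (W y)) (b Z) x • V x - b Z x • J x (bracket V W x)) := by
    intro Z W hZ hW
    rw [hPr hZ, bracket_swap _ U, bracket_swap _ V, hLU W hW, hLV W hW]
    module
  -- Derivatives along `P W` involve only U and V, where invariance of ζ and J replaces them by
  -- brackets.
  have hPP : ∀ {Z W : ∀ x : M, TangentSpace 𝓘(ℝ, E) x}, SmoothVF Z → SmoothVF W →
      dirDeriv (P W) (a Z) x
          = a W x * ζ x (bracket U Z x) + b W x * ζ x (bracket V Z x) ∧
        dirDeriv (P W) (b Z) x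
          = a W x * ζ x (J x (bracket U Z x)) + b W x * ζ x (J x (bracket V Z x)) := by
    intro Z W hZ hW
    simp only [P, dirDeriv_smul_add_smul]
    simp only [a, b]
    rw [hζLU Z hZ, hζLV Z hZ, hζLU _ (hZ.endo J), hζLV _ (hZ.endo J), hLU Z hZ, hLV Z hZ]
    exact ⟨rfl, rfl⟩
  have hPUV : bracket (P X) (P Y) x
      = (dirDeriv (P X) (a Y) x - dirDeriv (P Y) (a X) x) • U x
        + (dirDeriv (P X) (b Y) x - dirDeriv (P Y) (b X) x) • V x := by
    rw [hPr hY, bracket_swap (P X) U, bracket_swap (P X) V, hPr hX, hPr hX, hUU, hUV, hVU, hVV]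
    have e1 := (hPP hX hY).1
    have e2 := (hPP hX hY).2
    simp only [P, dirDeriv_smul_add_smul] at e1 e2 ⊢
    module
  have t1 := htype x (J x (X x)) (Y x)
  rw [sq, (extD ζ x).map_neg] at t1
  change -extD ζ x (X x) (J x (Y x)) = _ at t1
  rw [extD_eq ζ hX hJY, extD_eq ζ hJX hY] at t1
  have t2 := htype x (X x) (Y x)
  rw [extD_eq ζ hJX hJY, extD_eq ζ hX hY] at t2
  change -(dirDeriv X (b Y) x - dirDeriv (fun y => J y (Y y)) (a X) x - _)
    = dirDeriv (fun y => J y (X y)) (a Y) x - dirDeriv Y (b X) x - _ at t1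
  change dirDeriv (fun y => J y (X y)) (b Y) x - dirDeriv (fun y => J y (Y y)) (b X) x - _
    = dirDeriv X (a Y) x - dirDeriv Y (a X) x - _ at t2
  have n1 := hN X Y hX hY x
  rw [nijenhuis, sq] at n1
  have n2 : bracket (fun y => J y (X y)) (fun y => J y (Y y)) x = bracket X Y x
      + J x (bracket (fun y => J y (X y)) Y x) + J x (bracket X (fun y => J y (Y y)) x) := by
    rw [← sub_eq_zero, ← n1]
    abel
  rw [nijenhuis, hJt, hJt, bracket_sub_left hJX (hP hX), bracket_sub_right hJY (hP hY),
    bracket_sub_left hJX (hP hX), bracket_sub_right hJY (hP hY), bracket_sub_right hJY (hP hY),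
    bracket_swap (P X) Y, bracket_swap (P X) (fun y => J y (Y y)), hPUV, hPJ hY hX, hPJ hX hY,
    hPr hX, hPr hY, bracket_swap X U, bracket_swap X V, bracket_swap Y U, bracket_swap Y V, n2,
    (hPP hX hY).1, (hPP hX hY).2, (hPP hY hX).1, (hPP hY hX).2]
  rw [n2] at t2
  simp only [deformedEndo_apply, map_add, map_sub, map_neg, map_smul, sq, hJU, hJV, hζU, hζV]
    at t1 t2 ⊢
  -- After expansion the Nijenhuis tensor equals −(dζ(X, JY) + dζ(JX, Y)) U − (dζ(JX, JY) − dζ(X,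
  -- Y)) V. The hypotheses `t1` and `t2` are the vanishing of the two coefficients.
  linear_combination (norm := skip) t1 • U x - t2 • V x
  simp only [a, b]
  module

end DeformedEndo

/-! ### The deformed metric -/

section DeformedMetric

variable [T2Space M] {X Y Z : ∀ x : M, TangentSpace 𝓘(ℝ, E) x}
  {J : EndoField E M} {g : Metric E M} {θ ζ : OneForm E M}

/-- The bilinear form `g + dζ ∘ (J ⊗ Id) + ζ ⊗ θᶜ + θᶜ ⊗ ζ + ζ ⊗ ζ`. -/
def deformedForm (J : EndoField E M) (g : Metric E M) (θ ζ : OneForm E M) (x : M) :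
    TangentSpace 𝓘(ℝ, E) x →L[ℝ] TangentSpace 𝓘(ℝ, E) x →L[ℝ] ℝ :=
  g.inner x + (extD ζ x).comp (J x) + (ζ x).smulRight (antiLee J θ x)
    + (antiLee J θ x).smulRight (ζ x) + (ζ x).smulRight (ζ x)

lemma deformedForm_apply (x : M) (u v : TangentSpace 𝓘(ℝ, E) x) :
    deformedForm J g θ ζ x u v = g.inner x u v + extD ζ x (J x u) v
      + ζ x u * antiLee J θ x v + antiLee J θ x u * ζ x v + ζ x u * ζ x v := rfl

lemma contMDiff_deformedForm (J : EndoField E M) (g : Metric E M) (θ ζ : OneForm E M) :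
    ContMDiff 𝓘(ℝ, E) (𝓘(ℝ, E).prod 𝓘(ℝ, E →L[ℝ] E →L[ℝ] ℝ)) ∞
      (fun x => TotalSpace.mk' (E →L[ℝ] E →L[ℝ] ℝ)
        (E := fun x : M => TangentSpace 𝓘(ℝ, E) x →L[ℝ] TangentSpace 𝓘(ℝ, E) x →L[ℝ] ℝ)
          x (deformedForm J g θ ζ x)) :=
  contMDiff_bilin_of_apply fun _ _ hX hY =>
    ((((metric_contMDiff g hX hY).add (contMDiff_extD_apply ζ (hX.endo J) hY)).add
      ((ζ.contMDiff_apply hX).mul (contMDiff_antiLee_apply J θ hY))).add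
        ((contMDiff_antiLee_apply J θ hX).mul (ζ.contMDiff_apply hY))).add
          ((ζ.contMDiff_apply hX).mul (ζ.contMDiff_apply hY))

/-- Type (1,1) gives dζ(Ju, v) = −dζ(u, Jv) = dζ(Jv, u), the only summand whose symmetry is not
evident. -/
lemma deformedForm_symm (sq : ∀ (x : M) (v : TangentSpace 𝓘(ℝ, E) x), J x (J x v) = -v)
    (htype : ∀ (x : M) (u v : TangentSpace 𝓘(ℝ, E) x),
      extD ζ x (J x u) (J x v) = extD ζ x u v) (x : M) (u v : TangentSpace 𝓘(ℝ, E) x) :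
    deformedForm J g θ ζ x u v = deformedForm J g θ ζ x v u := by
  have h : extD ζ x (J x u) v = extD ζ x (J x v) u := by
    rw [← htype x (J x u) v, sq, (extD ζ x).map_neg, extD_swap ζ x (J x v)]
    rfl
  rw [deformedForm_apply, deformedForm_apply, h, g.symm]
  ring

/-- A Vaisman structure with Lee form of norm one, together with a basic form `ζ` whose exterior
derivative is of type `(1,1)`. -/
structure IsDeformationData (J : EndoField E M) (g : Metric E M) (θ ζ : OneForm E M) : Prop where
  isVaisman : IsVaisman J g θ
  normOne_eq : ∀ x, normOne g x (θ x) = 1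
  isBasic : IsBasic (canonicalFoliation J g θ) ζ
  type : ∀ (x : M) (u v : TangentSpace 𝓘(ℝ, E) x), extD ζ x (J x u) (J x v) = extD ζ x u v

namespace IsDeformationData

variable (h : IsDeformationData J g θ ζ)
include h

lemma smooth_anti : SmoothVF (antiLeeField J g θ) := h.isVaisman.smoothVF_antiLeeField θ

lemma lee_apply_lee (x : M) : θ x (leeField g θ x) = 1 :=
  apply_leeField_of_normOne h.normOne_eq x

lemma lee_apply_anti (x : M) : θ x (antiLeeField J g θ x) = 0 :=
  h.isVaisman.apply_antiLeeField θ x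

lemma endo_lee (x : M) : J x (leeField g θ x) = antiLeeField J g θ x :=
  (h.isVaisman.antiLeeField_eq θ x).symm

lemma endo_anti (x : M) : J x (antiLeeField J g θ x) = - leeField g θ x :=
  h.isVaisman.endo_antiLeeField θ x

lemma antiLee_apply_lee (x : M) : antiLee J θ x (leeField g θ x) = 0 := by
  rw [antiLee_apply, h.endo_lee, h.lee_apply_anti, neg_zero]

lemma antiLee_apply_anti (x : M) : antiLee J θ x (antiLeeField J g θ x) = 1 := by
  rw [antiLee_apply, h.endo_anti, map_neg, neg_neg, h.lee_apply_lee]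

lemma lee_mem (x : M) : leeField g θ x ∈ canonicalFoliation J g θ x :=
  Submodule.subset_span (Or.inl rfl)

lemma anti_mem (x : M) : antiLeeField J g θ x ∈ canonicalFoliation J g θ x :=
  Submodule.subset_span (Or.inr rfl)

lemma apply_lee (x : M) : ζ x (leeField g θ x) = 0 :=
  (h.isBasic _ (smoothVF_leeField g θ) h.lee_mem).1 x

lemma apply_anti (x : M) : ζ x (antiLeeField J g θ x) = 0 :=
  (h.isBasic _ h.smooth_anti h.anti_mem).1 x

lemma extD_lee (x : M) (v : TangentSpace 𝓘(ℝ, E) x) : extD ζ x (leeField g θ x) v = 0 :=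
  h.isBasic.extD_eq_zero (smoothVF_leeField g θ) h.lee_mem x v

lemma extD_anti (x : M) (v : TangentSpace 𝓘(ℝ, E) x) : extD ζ x (antiLeeField J g θ x) v = 0 :=
  h.isBasic.extD_eq_zero h.smooth_anti h.anti_mem x v

lemma extD_lee_right (x : M) (v : TangentSpace 𝓘(ℝ, E) x) : extD ζ x v (leeField g θ x) = 0 :=
  h.isBasic.extD_eq_zero_right (smoothVF_leeField g θ) h.lee_mem x v

lemma extD_anti_right (x : M) (v : TangentSpace 𝓘(ℝ, E) x) :
    extD ζ x v (antiLeeField J g θ x) = 0 :=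
  h.isBasic.extD_eq_zero_right h.smooth_anti h.anti_mem x v

omit h in
lemma inner_anti (x : M) (v : TangentSpace 𝓘(ℝ, E) x) :
    g.inner x (antiLeeField J g θ x) v = antiLee J θ x v := inner_sharp g x _ v

/-- This keeps U as the dual of θ for the new metric. -/
lemma deformedForm_lee (x : M) (v : TangentSpace 𝓘(ℝ, E) x) :
    deformedForm J g θ ζ x (leeField g θ x) v = θ x v := by
  rw [deformedForm_apply, h.endo_lee, h.extD_anti, h.apply_lee, h.antiLee_apply_lee,
    inner_leeField]
  ring

/-- The covector θᶜ + ζ is the anti-Lee form −θ∘J_t of the new structure, so V remains the anti-Lee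
field. -/
lemma deformedForm_anti (x : M) (v : TangentSpace 𝓘(ℝ, E) x) :
    deformedForm J g θ ζ x (antiLeeField J g θ x) v = antiLee J θ x v + ζ x v := by
  have e : extD ζ x (J x (antiLeeField J g θ x)) v = 0 := by
    rw [h.endo_anti, (extD ζ x).map_neg]
    exact neg_eq_zero.2 (h.extD_lee x v)
  rw [deformedForm_apply, e, h.apply_anti, h.antiLee_apply_anti, inner_anti]
  ring

/-- The forms ζ and dζ vanish on U and V, so they see only w. The terms q² + 2qζ(w) + ζ(w)² form a
complete square. -/
lemma deformedForm_self (x : M) (w : TangentSpace 𝓘(ℝ, E) x) (p q : ℝ)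
    (hp : θ x w = 0) (hq : antiLee J θ x w = 0) :
    deformedForm J g θ ζ x (w + p • leeField g θ x + q • antiLeeField J g θ x)
        (w + p • leeField g θ x + q • antiLeeField J g θ x)
      = g.inner x w w + extD ζ x (J x w) w + p ^ 2 + (q + ζ x w) ^ 2 := by
  have hs := deformedForm_symm (g := g) (θ := θ) h.isVaisman.sq h.type x w
  simp only [map_add, map_smul, add_apply, smul_apply, smul_eq_mul, h.deformedForm_lee,
    h.deformedForm_anti, hs (leeField g θ x), hs (antiLeeField J g θ x), h.lee_apply_lee,
    h.lee_apply_anti, h.antiLee_apply_lee, h.antiLee_apply_anti, h.apply_lee, h.apply_anti, hp, hq]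
  rw [deformedForm_apply, hq]
  ring

lemma deformedForm_pos (hpos : ∀ (x : M) (v : TangentSpace 𝓘(ℝ, E) x), g.inner x v v = 1 →
    -1 < extD ζ x (J x v) v) (x : M) (v : TangentSpace 𝓘(ℝ, E) x) (hv : v ≠ 0) :
    0 < deformedForm J g θ ζ x v v := by
  set p := θ x v with hp
  set q := antiLee J θ x v with hq
  set w := v - p • leeField g θ x - q • antiLeeField J g θ x with hw
  have hvw : v = w + p • leeField g θ x + q • antiLeeField J g θ x := by rw [hw]; abel
  have h1 : θ x w = 0 := by
    simp [hw, h.lee_apply_lee, h.lee_apply_anti, ← hp]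
  have h2 : antiLee J θ x w = 0 := by
    simp [hw, h.antiLee_apply_lee, h.antiLee_apply_anti, ← hq]
  rw [hvw, h.deformedForm_self x w p q h1 h2]
  by_cases hw0 : w = 0
  · have hpq : 0 < p ^ 2 + q ^ 2 := by
      by_contra hcon
      have hp0 : p = 0 := by nlinarith [sq_nonneg p, sq_nonneg q]
      have hq0 : q = 0 := by nlinarith [sq_nonneg p, sq_nonneg q]
      exact hv (by rw [hvw, hw0, hp0, hq0]; simp)
    simp only [hw0, map_zero, add_zero, zero_add]
    exact hpq
  · have hg := g.pos x w hw0
    -- The lower bound is assumed on unit vectors; rescaling w gives g(w, w) + dζ(Jw, w) > 0.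
    set c := Real.sqrt (g.inner x w w) with hc
    have hc0 : 0 < c := Real.sqrt_pos.2 hg
    have hcc : c * c = g.inner x w w := Real.mul_self_sqrt hg.le
    have h3 := hpos x (c⁻¹ • w) (by
      simp only [map_smul, smul_apply, smul_eq_mul, ← hcc]
      field_simp)
    simp only [map_smul, smul_apply, smul_eq_mul] at h3
    have h4 : c * c * (c⁻¹ * (c⁻¹ * extD ζ x (J x w) w)) = extD ζ x (J x w) w := by
      field_simp
    have h5 := mul_lt_mul_of_pos_left h3 (mul_pos hc0 hc0)
    rw [h4, hcc] at h5
    nlinarith [sq_nonneg p, sq_nonneg (q + ζ x w)]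

end IsDeformationData

/-- The Riemannian metric `g + dζ ∘ (J ⊗ Id) + ζ ⊗ θᶜ + θᶜ ⊗ ζ + ζ ⊗ ζ`. -/
def deformedMetric (h : IsDeformationData J g θ ζ)
    (hpos : ∀ (x : M) (v : TangentSpace 𝓘(ℝ, E) x), g.inner x v v = 1 →
      -1 < extD ζ x (J x v) v) : Metric E M where
  inner := deformedForm J g θ ζ
  symm := deformedForm_symm h.isVaisman.sq h.type
  pos := h.deformedForm_pos hpos
  isVonNBounded x := isVonNBounded_of_posDef (F := E) (deformedForm J g θ ζ x)
    (h.deformedForm_pos hpos x)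
  contMDiff := contMDiff_deformedForm J g θ ζ

end DeformedMetric

/-! ### The deformed Vaisman structure -/

section DeformedVaisman

variable [T2Space M] {X Y Z : ∀ x : M, TangentSpace 𝓘(ℝ, E) x}
  {J : EndoField E M} {g : Metric E M} {θ ζ : OneForm E M}

namespace IsDeformationData

/-- The complex structure `J - U ⊗ ζ - V ⊗ (ζ ∘ J)`, where `U` and `V` are the Lee and anti-Lee
fields. -/
abbrev endo (h : IsDeformationData J g θ ζ) : EndoField E M :=
  deformedEndo J (smoothVF_leeField g θ) h.smooth_anti ζ

variable (h : IsDeformationData J g θ ζ)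
include h

lemma endo_apply (x : M) (v : TangentSpace 𝓘(ℝ, E) x) : h.endo x v
    = J x v - ζ x v • leeField g θ x - ζ x (J x v) • antiLeeField J g θ x := rfl

lemma form_endo (x : M) (v : TangentSpace 𝓘(ℝ, E) x) : ζ x (h.endo x v) = ζ x (J x v) := by
  simp [h.endo_apply, h.apply_lee, h.apply_anti]

lemma lee_endo (x : M) (v : TangentSpace 𝓘(ℝ, E) x) :
    θ x (h.endo x v) = θ x (J x v) - ζ x v := by
  simp [h.endo_apply, h.lee_apply_lee, h.lee_apply_anti]

lemma endo_endo (x : M) (v : TangentSpace 𝓘(ℝ, E) x) : h.endo x (h.endo x v) = -v := by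
  have e : J x (h.endo x v) = -v - ζ x v • antiLeeField J g θ x + ζ x (J x v) • leeField g θ x := by
    rw [h.endo_apply, map_sub, map_sub, map_smul, map_smul, h.isVaisman.sq, h.endo_lee,
      h.endo_anti]
    module
  rw [h.endo_apply x (h.endo x v), h.form_endo, e]
  simp only [map_add, map_sub, map_neg, map_smul, h.apply_lee, h.apply_anti]
  module

/-- The new fundamental form is ω + dζ − θ∧ζ: the corrections in J_t absorb the ζ ⊗ ζ and θᶜ terms
of g_t. -/
lemma deformedForm_endo_right (x : M) (u v : TangentSpace 𝓘(ℝ, E) x) :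
    deformedForm J g θ ζ x u (h.endo x v) = fundamentalForm J g x u v + extD ζ x u v
      - θ x u * ζ x v + θ x v * ζ x u := by
  have e1 : g.inner x u (leeField g θ x) = θ x u := by rw [g.symm, inner_leeField]
  have e2 : g.inner x u (antiLeeField J g θ x) = antiLee J θ x u := by rw [g.symm, inner_anti]
  rw [deformedForm_apply, h.form_endo, antiLee_apply J θ x (h.endo x v)]
  rw [h.endo_apply]
  simp only [map_sub, map_smul, smul_eq_mul, e1, e2, h.extD_lee_right, h.extD_anti_right,
    h.type, h.endo_lee, h.endo_anti, h.isVaisman.sq, map_neg, h.lee_apply_anti, h.lee_apply_lee,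
    fundamentalForm]
  ring

lemma deformedForm_endo (x : M) (u v : TangentSpace 𝓘(ℝ, E) x) :
    deformedForm J g θ ζ x (h.endo x u) (h.endo x v) = deformedForm J g θ ζ x u v := by
  rw [deformedForm_endo_right, h.form_endo, h.lee_endo, fundamentalForm,
    h.isVaisman.inner_endo_right]
  have e : J x (h.endo x u)
      = -u - ζ x u • antiLeeField J g θ x + ζ x (J x u) • leeField g θ x := by
    rw [h.endo_apply, map_sub, map_sub, map_smul, map_smul, h.isVaisman.sq, h.endo_lee,
      h.endo_anti]
    module
  have e' : extD ζ x (h.endo x u) v = extD ζ x (J x u) v := by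
    rw [h.endo_apply]
    simp only [map_sub, map_smul, sub_apply, smul_apply, h.extD_lee, h.extD_anti, smul_eq_mul]
    ring
  have e'' : g.inner x (J x (h.endo x u)) v
      = - g.inner x u v - ζ x u * antiLee J θ x v + ζ x (J x u) * θ x v := by
    rw [e]
    simp only [map_sub, map_add, map_smul, add_apply, sub_apply, smul_apply, inner_leeField,
      inner_anti, smul_eq_mul, (g.inner x).map_neg]
    rfl
  rw [e', e'', deformedForm_apply, antiLee_apply J θ x u]
  ring

variable (hpos : ∀ (x : M) (v : TangentSpace 𝓘(ℝ, E) x), g.inner x v v = 1 →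
  -1 < extD ζ x (J x v) v)

lemma leeField_deformedMetric : leeField (deformedMetric h hpos) θ = leeField g θ :=
  funext fun x => sharp_eq _ (h.deformedForm_lee x)

lemma antiLeeField_deformedMetric :
    antiLeeField h.endo (deformedMetric h hpos) θ = antiLeeField J g θ := by
  funext x
  refine sharp_eq _ fun v => ?_
  change deformedForm J g θ ζ x _ _ = _
  rw [h.deformedForm_anti, antiLee_apply, antiLee_apply, h.lee_endo]
  ring

lemma isHermitianStructure_deformed :
    IsHermitianStructure h.endo (deformedMetric h hpos) where
  sq := h.endo_endo
  integrable _ _ hX hY x :=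
    nijenhuis_deformedEndo (smoothVF_leeField g θ) h.smooth_anti h.isVaisman.sq
      h.isVaisman.integrable h.endo_lee (fun _ hZ => h.isVaisman.bracket_leeField_endo hZ)
      (fun _ hZ => h.isVaisman.bracket_antiLeeField_endo hZ) h.apply_lee h.apply_anti
      (fun _ hZ => h.isBasic.dirDeriv_eq (smoothVF_leeField g θ) h.lee_mem hZ)
      (fun _ hZ => h.isBasic.dirDeriv_eq h.smooth_anti h.anti_mem hZ) h.type hX hY x
  compatible := h.deformedForm_endo

/-- U is Killing for the new metric, since each of g, J, dζ, ζ and θᶜ is invariant under U and the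
Leibniz rule does the rest. -/
lemma dirDeriv_lee_deformedForm (hY : SmoothVF Y) (hZ : SmoothVF Z) (x : M) :
    dirDeriv (leeField g θ) (fun y => deformedForm J g θ ζ y (Y y) (Z y)) x
      = deformedForm J g θ ζ x (bracket (leeField g θ) Y x) (Z x)
        + deformedForm J g θ ζ x (Y x) (bracket (leeField g θ) Z x) := by
  have hU := smoothVF_leeField g θ
  have s1 := metric_contMDiff g hY hZ
  have s2 := contMDiff_extD_apply ζ (hY.endo J) hZ
  have s3 := ζ.contMDiff_apply hY
  have s4 := ζ.contMDiff_apply hZ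
  have s5 := contMDiff_antiLee_apply J θ hY
  have s6 := contMDiff_antiLee_apply J θ hZ
  simp only [deformedForm_apply]
  refine (dirDeriv_add (((s1.add s2).add (s3.mul s6)).add (s5.mul s4)) (s3.mul s4) x).trans ?_
  rw [dirDeriv_add ((s1.add s2).add (s3.mul s6)) (s5.mul s4),
    dirDeriv_add (s1.add s2) (s3.mul s6), dirDeriv_add s1 s2, dirDeriv_mul s3 s6,
    dirDeriv_mul s5 s4, dirDeriv_mul s3 s4, h.isVaisman.parallel.killing hY hZ,
    h.isBasic.dirDeriv_extD hU h.lee_mem (hY.endo J) hZ,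
    h.isVaisman.bracket_leeField_endo hY, h.isBasic.dirDeriv_eq hU h.lee_mem hY,
    h.isBasic.dirDeriv_eq hU h.lee_mem hZ, h.isVaisman.dirDeriv_leeField_antiLee h.normOne_eq hY,
    h.isVaisman.dirDeriv_leeField_antiLee h.normOne_eq hZ]
  ring

lemma isParallel_deformedMetric : IsParallel (deformedMetric h hpos) θ := by
  refine isParallel_of_killing h.isVaisman.parallel.extD_eq_zero fun Y Z hY hZ x => ?_
  rw [h.leeField_deformedMetric hpos]
  exact h.dirDeriv_lee_deformedForm hY hZ x

lemma dirDeriv_fundamentalForm (hY : SmoothVF Y) (hZ : SmoothVF Z) (x : M) :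
    dirDeriv X (fun y => fundamentalForm h.endo (deformedMetric h hpos) y (Y y) (Z y)) x
      = dirDeriv X (fun y => fundamentalForm J g y (Y y) (Z y)) x
        + dirDeriv X (fun y => extD ζ y (Y y) (Z y)) x
        - (θ x (Y x) * dirDeriv X (fun y => ζ y (Z y)) x
          + ζ x (Z x) * dirDeriv X (fun y => θ y (Y y)) x)
        + (θ x (Z x) * dirDeriv X (fun y => ζ y (Y y)) x
          + ζ x (Y x) * dirDeriv X (fun y => θ y (Z y)) x) := by
  have s1 := metric_contMDiff g hY (hZ.endo J)
  have s2 := contMDiff_extD_apply ζ hY hZ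
  have s3 := ζ.contMDiff_apply hY
  have s4 := ζ.contMDiff_apply hZ
  have s5 := θ.contMDiff_apply hY
  have s6 := θ.contMDiff_apply hZ
  refine (congrArg (dirDeriv X · x)
    (funext fun y => h.deformedForm_endo_right y (Y y) (Z y))).trans ?_
  refine (dirDeriv_add ((s1.add s2).sub (s5.mul s4)) (s6.mul s3) x).trans ?_
  change dirDeriv X (_ - _) x + _ = _
  rw [dirDeriv_sub (s1.add s2) (s5.mul s4),
    dirDeriv_add s1 s2, dirDeriv_mul s5 s4, dirDeriv_mul s6 s3]
  rfl

/-- d(ω + dζ − θ∧ζ) = θ∧ω + θ∧dζ because dθ = 0, and this is θ∧(ω + dζ − θ∧ζ) because θ∧θ = 0. -/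
lemma cartanTwo_fundamentalForm (hX : SmoothVF X) (hY : SmoothVF Y) (hZ : SmoothVF Z) (x : M) :
    cartanTwo (fundamentalForm h.endo (deformedMetric h hpos)) X Y Z x
      = wedgeOneTwo θ (fundamentalForm h.endo (deformedMetric h hpos)) x (X x) (Y x) (Z x) := by
  have e : ∀ u v : TangentSpace 𝓘(ℝ, E) x,
      fundamentalForm h.endo (deformedMetric h hpos) x u v = fundamentalForm J g x u v
        + extD ζ x u v - θ x u * ζ x v + θ x v * ζ x u := h.deformedForm_endo_right x
  have closed := h.isVaisman.parallel.extD_eq_zero x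
  have c1 := closed (X x) (Y x)
  have c2 := closed (X x) (Z x)
  have c3 := closed (Y x) (Z x)
  rw [extD_eq θ hX hY] at c1
  rw [extD_eq θ hX hZ] at c2
  rw [extD_eq θ hY hZ] at c3
  have l := h.isVaisman.lee X Y Z hX hY hZ x
  have z := cartanTwo_extD ζ hX hY hZ x
  simp only [cartanTwo, wedgeOneTwo] at l z ⊢
  rw [h.dirDeriv_fundamentalForm hpos hY hZ, h.dirDeriv_fundamentalForm hpos hX hZ,
    h.dirDeriv_fundamentalForm hpos hX hY]
  simp only [e]
  rw [extD_eq ζ hX hY, extD_eq ζ hX hZ, extD_eq ζ hY hZ]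
  -- The last three terms are the contribution −dθ∧ζ of −d(θ∧ζ).
  linear_combination l + z - ζ x (Z x) * c1 + ζ x (Y x) * c2 - ζ x (X x) * c3

theorem isVaisman_deformed : IsVaisman h.endo (deformedMetric h hpos) θ where
  toIsHermitianStructure := h.isHermitianStructure_deformed hpos
  nonzero := h.isVaisman.nonzero
  parallel := h.isParallel_deformedMetric hpos
  lee _ _ _ hX hY hZ x := h.cartanTwo_fundamentalForm hpos hX hY hZ x

lemma normOne_deformedMetric (x : M) : normOne (deformedMetric h hpos) x (θ x) = 1 := by
  have e : sharp (deformedMetric h hpos) x (θ x) = leeField g θ x :=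
    congrFun (h.leeField_deformedMetric hpos) x
  rw [normOne_eq_sqrt, e, h.lee_apply_lee, Real.sqrt_one]

lemma canonicalFoliation_deformed (x : M) :
    canonicalFoliation h.endo (deformedMetric h hpos) θ x = canonicalFoliation J g θ x := by
  rw [canonicalFoliation, h.leeField_deformedMetric, h.antiLeeField_deformedMetric,
    canonicalFoliation]

end IsDeformationData

end DeformedVaisman

end Vaisman
end

/-! ### The main theorem -/

open Vaisman
theorem theorem3 {n : ℕ} (hn : 1 ≤ n)
    {E : Type*} [NormedAddCommGroup E] [NormedSpace ℝ E] [FiniteDimensional ℝ E]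
    (hE : finrank ℝ E = 2 * n + 2)
    {M : Type*} [TopologicalSpace M] [ChartedSpace E M] [IsManifold 𝓘(ℝ, E) ∞ M]
    [T2Space M] [CompactSpace M] [ConnectedSpace M]
    (J : EndoField E M) (g : Metric E M) (θ : OneForm E M)
    (hV : IsVaisman J g θ) (hθ : ∀ x, normOne g x (θ x) = 1)
    (ζ : ℝ → OneForm E M) (t : ℝ)
    (hbasic : IsBasic (canonicalFoliation J g θ) (ζ t))
    (htype : ∀ (x : M) (u v : TangentSpace 𝓘(ℝ, E) x),
      extD (ζ t) x (J x u) (J x v) = extD (ζ t) x u v)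
    (hbound₁ : ∀ x, normOne g x (ζ t x)
      < 1 / ((2 ^ (n + 1) - 1) * (n : ℝ) ^ (((n : ℝ) - 1) / 2)))
    (hbound₂ : ∀ x, normTwo g x (extD (ζ t) x)
      < 1 / ((2 ^ (n + 1) - 1) * (n : ℝ) ^ (((n : ℝ) - 1) / 2)))
    (hpos : ∀ (x : M) (v : TangentSpace 𝓘(ℝ, E) x), g.inner x v v = 1 →
      -1 < extD (ζ t) x (J x v) v) :
    ∃ (Jt : EndoField E M) (gt : Metric E M),
      (∀ (x : M) (v : TangentSpace 𝓘(ℝ, E) x),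
        Jt x v = J x v - ζ t x v • leeField g θ x - ζ t x (J x v) • antiLeeField J g θ x) ∧
      (∀ (x : M) (u v : TangentSpace 𝓘(ℝ, E) x),
        gt.inner x u v = g.inner x u v + extD (ζ t) x (J x u) v
          + ζ t x u * antiLee J θ x v + antiLee J θ x u * ζ t x v + ζ t x u * ζ t x v) ∧
      IsVaisman Jt gt θ ∧
      (∀ x, normOne gt x (θ x) = 1) ∧
      ∀ x, canonicalFoliation Jt gt θ x = canonicalFoliation J g θ x := by
  have h : IsDeformationData J g θ (ζ t) := ⟨hV, hθ, hbasic, htype⟩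
  exact ⟨h.endo, deformedMetric h hpos, h.endo_apply, fun _ _ _ => rfl, h.isVaisman_deformed hpos,
    h.normOne_deformedMetric hpos, h.canonicalFoliation_deformed hpos⟩
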